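/- Let $n, m \ge 0$ and $k \ge 1$ be integers. An \emph{open matching diagram} of length $n$ consists of $n$ dots $1,\dots,n$ on a line, a set of closed arcs $(i,j)$ with $i<j$, and a set of open arcs, each having only a left endpoint, such that every dot is an endpoint of exactly one arc (closed or open). A \emph{plain $k$-crossing} (resp. \emph{plain $k$-nesting}) of such a diagram is a set of $k$ closed arcs $(i_1,j_1),\dots,(i_k,j_k)$ with $i_1<\dots<i_k<j_1<\dots<j_k$ (resp. $i_1<\dots<i_k<j_k<\dots<j_1$). Then the following four classes are in bijection: (i) the standard Young tableaux of size $n$ with exactly $m$ columns of odd length and height (number of rows) at most $2k-1$; (ii) the involutions of $\{1,\dots,n\}$ with exactly $m$ fixed points and no decreasing subsequence of length $2k$; (iii) the open matching diagrams of length $n$ with exactly $m$ open arcs and no plain $k$-crossing; (iv) the open matching diagrams of length $n$ with exactly $m$ open arcs and no plain $k$-nesting. An involution is a permutation $\sigma$ with $\sigma^2=\mathrm{id}$ (the identity included). -/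

import Mathlib

/-- A standard Young tableau of size `n`: a semistandard Young tableau of some shape in which each
of the numbers `1, …, n` occurs in exactly one cell (hence the rows, too, are strictly increasing
and the shape has `n` cells). -/
structure StandardTableau (n : ℕ) where
  /-- The underlying Ferrers diagram. -/
  shape : YoungDiagram
  /-- The filling. -/
  tableau : SemistandardYoungTableau shape
  /-- The entries are `1, …, n`, each occurring once. -/
  bijOn : Set.BijOn (fun c : ℕ × ℕ => tableau c.1 c.2) (shape.cells : Set (ℕ × ℕ)) (Set.Icc 1 n)

namespace StandardTableau

variable {n : ℕ}

/-- The height: the number of rows, that is, the length of the first column. -/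
def height (T : StandardTableau n) : ℕ :=
  T.shape.colLen 0

/-- The number of columns of odd length. (The columns are indexed by `j < T.shape.rowLen 0`.) -/
def numOddColumns (T : StandardTableau n) : ℕ :=
  ((Finset.range (T.shape.rowLen 0)).filter (fun j => Odd (T.shape.colLen j))).card

end StandardTableau

/-- The sequence `σ 0, σ 1, …, σ (n - 1)` has a decreasing subsequence of length `l`. -/
def HasDecreasingSubseq {n : ℕ} (σ : Equiv.Perm (Fin n)) (l : ℕ) : Prop :=
  ∃ i : Fin l → Fin n, StrictMono i ∧ StrictAnti (fun a => σ (i a))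

/-- An open matching diagram on a row of `n` dots (labelled by `Fin n`): a set of closed arcs
`(i, j)` with `i < j`, and a set of open arcs, each given by its left endpoint, such that every dot
is an endpoint of exactly one arc, closed or open. -/
structure OpenMatching (n : ℕ) where
  /-- The closed arcs, as pairs (left endpoint, right endpoint). -/
  arcs : Finset (Fin n × Fin n)
  /-- The left endpoints of the open arcs. -/
  openArcs : Finset (Fin n)
  /-- The left endpoint of a closed arc is to the left of its right endpoint. -/
  lt_of_mem : ∀ p ∈ arcs, p.1 < p.2
  /-- Two closed arcs with a common endpoint are equal. -/
  eq_of_common_endpoint : ∀ p ∈ arcs, ∀ q ∈ arcs, ∀ d : Fin n,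
    (d = p.1 ∨ d = p.2) → (d = q.1 ∨ d = q.2) → p = q
  /-- The left endpoint of an open arc is not an endpoint of a closed arc. -/
  not_mem_openArcs : ∀ p ∈ arcs, p.1 ∉ openArcs ∧ p.2 ∉ openArcs
  /-- There are no isolated dots. -/
  covered : ∀ d : Fin n, d ∈ openArcs ∨ ∃ p ∈ arcs, d = p.1 ∨ d = p.2

namespace OpenMatching

variable {n : ℕ}

/-- A plain `k`-crossing: closed arcs `(i₁, j₁), …, (iₖ, jₖ)` with
`i₁ < i₂ < ⋯ < iₖ < j₁ < j₂ < ⋯ < jₖ`. -/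
def HasPlainCrossing (M : OpenMatching n) (k : ℕ) : Prop :=
  ∃ i j : Fin k → Fin n, (∀ a, (i a, j a) ∈ M.arcs) ∧
    StrictMono i ∧ StrictMono j ∧ ∀ a b, i a < j b

/-- A plain `k`-nesting: closed arcs `(i₁, j₁), …, (iₖ, jₖ)` with
`i₁ < i₂ < ⋯ < iₖ < jₖ < ⋯ < j₂ < j₁`. -/
def HasPlainNesting (M : OpenMatching n) (k : ℕ) : Prop :=
  ∃ i j : Fin k → Fin n, (∀ a, (i a, j a) ∈ M.arcs) ∧
    StrictMono i ∧ StrictAnti j ∧ ∀ a b, i a < j b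

end OpenMatching

/-- Standard Young tableaux of size `n` with `m` odd columns and height at most `h`. -/
def tableauxClass (n m h : ℕ) : Set (StandardTableau n) :=
  {T | T.numOddColumns = m ∧ T.height ≤ h}

/-- Involutions of size `n` with `m` fixed points and no decreasing subsequence of length `l`. -/
def involutionsClass (n m l : ℕ) : Set (Equiv.Perm (Fin n)) :=
  {σ | Function.Involutive σ ∧ (Function.fixedPoints σ).ncard = m ∧ ¬ HasDecreasingSubseq σ l}

/-- Open matching diagrams of length `n` with `m` open arcs and no plain `k`-crossing. -/
def noncrossingClass (n m k : ℕ) : Set (OpenMatching n) :=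
  {M | M.openArcs.card = m ∧ ¬ M.HasPlainCrossing k}

/-- Open matching diagrams of length `n` with `m` open arcs and no plain `k`-nesting. -/
def nonnestingClass (n m k : ℕ) : Set (OpenMatching n) :=
  {M | M.openArcs.card = m ∧ ¬ M.HasPlainNesting k}

/-! Everything rests on growth diagrams. A filling of the quarter plane with at most one marked cell
in each row and column gets a Young diagram at every corner `(i, j)`: the Robinson–Schensted shape
of the cells below and to the left of it. Here that shape is defined through Viennot's shadow lines:
its row `r` has length `lis (skel^[r] F) i j`. Row 0 then measures the longest increasing chain, and
since each passage to the skeleton shortens decreasing chains by exactly one cell, column 0 measures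
the longest decreasing chain (`lis_skel_iterate_pos_iff`).

Labels of adjacent corners differ by at most one cell, and Fomin's local rule is reversible
(`local_unique`, `exists_localRule`). Hence a filling of a staircase amounts to the sequence of
labels along its boundary (`eq_of_label_eq`, `exists_filling`). Three correspondences follow.

Crossings and nestings: put the closed arcs of a matching in a staircase, so that plain crossings
become decreasing chains and plain nestings increasing chains, each inside a rectangle with a corner
on the boundary. Transposing all boundary labels exchanges the two. It also preserves the steps at
which the label changes, hence the left endpoints, the right endpoints and the open dots.

Nestings and involutions: the closed arcs are the 2-cycles and the open arcs the fixed points. A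
`k`-nesting read around gives a decreasing subsequence of length `2 * k`; conversely half of such a
subsequence consists of left endpoints, or half of right endpoints, of nested arcs.

Involutions and tableaux: a symmetric filling of the staircase of size `2 * n` has symmetric
boundary labels, so one half of them suffices, and for a permutation matrix that half is a chain of
diagrams growing by one cell at a time, that is, a standard tableau. The fixed points are counted by
an alternating sum of row lengths, which is the number of odd columns. -/

/-! ### Longest increasing chains in a filling of the quarter plane -/

/-- A partial permutation matrix: at most one marked cell in each row and each column. -/
def IsPartialPerm (F : ℕ → ℕ → Prop) : Prop :=
  (∀ u v v', F u v → F u v' → v = v') ∧ ∀ u u' v, F u v → F u' v → u = u'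

open Classical in
/-- The length of a longest increasing chain of marked cells `(u, v)` with `u < i` and `v < j`. -/
noncomputable def lis (F : ℕ → ℕ → Prop) : ℕ → ℕ → ℕ
  | 0, _ => 0
  | _ + 1, 0 => 0
  | i + 1, j + 1 =>
    max (max (lis F (i + 1) j) (lis F i (j + 1))) (if F i j then lis F i j + 1 else 0)

/-- Viennot's skeleton of a filling. -/
def skel (F : ℕ → ℕ → Prop) (i j : ℕ) : Prop :=
  ¬ F i j ∧ lis F i (j + 1) = lis F i j + 1 ∧ lis F (i + 1) j = lis F i j + 1

section lis

variable {F G : ℕ → ℕ → Prop} {i j : ℕ}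

theorem IsPartialPerm.flip (hF : IsPartialPerm F) : IsPartialPerm (flip F) :=
  ⟨fun u v v' h h' => hF.2 v v' u h h', fun u u' v h h' => hF.1 v u u' h h'⟩

@[simp] theorem lis_zero_left (j : ℕ) : lis F 0 j = 0 := by simp [lis]

@[simp] theorem lis_zero_right (i : ℕ) : lis F i 0 = 0 := by cases i <;> simp [lis]

open Classical in
theorem lis_succ_succ (i j : ℕ) : lis F (i + 1) (j + 1) =
    max (max (lis F (i + 1) j) (lis F i (j + 1))) (if F i j then lis F i j + 1 else 0) := by
  rw [lis]

theorem lis_flip (i j : ℕ) : lis (flip F) i j = lis F j i := by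
  induction i generalizing j with
  | zero => simp
  | succ i ih =>
    induction j with
    | zero => simp
    | succ j ihj =>
      rw [lis_succ_succ, lis_succ_succ, ihj, ih, ih, max_comm (lis F (j + 1) i)]
      rfl

theorem skel_flip : skel (flip F) = flip (skel F) := by
  funext i j
  simp only [skel, lis_flip, flip]
  exact propext (and_congr_right fun _ => and_comm)

theorem lis_le_succ_left (i j : ℕ) : lis F i j ≤ lis F (i + 1) j := by
  cases j with
  | zero => simp
  | succ j => rw [lis_succ_succ]; exact le_max_of_le_left (le_max_right _ _)

theorem lis_le_succ_right (i j : ℕ) : lis F i j ≤ lis F i (j + 1) := by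
  rw [← lis_flip (F := F), ← lis_flip (F := F)]; exact lis_le_succ_left j i

theorem lis_mono {i i' j j' : ℕ} (hi : i ≤ i') (hj : j ≤ j') : lis F i j ≤ lis F i' j' :=
  (monotone_nat_of_le_succ (f := fun i => lis F i j) (fun i => lis_le_succ_left i j) hi).trans
    (monotone_nat_of_le_succ (f := fun j => lis F i' j) (fun j => lis_le_succ_right i' j) hj)

theorem lis_succ_left_le (i j : ℕ) : lis F (i + 1) j ≤ lis F i j + 1 := by
  induction j with
  | zero => simp
  | succ j ih =>
    rw [lis_succ_succ]
    have := lis_le_succ_right (F := F) i j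
    split_ifs <;> omega

theorem lis_succ_right_le (i j : ℕ) : lis F i (j + 1) ≤ lis F i j + 1 := by
  rw [← lis_flip (F := F), ← lis_flip (F := F)]; exact lis_succ_left_le j i

theorem lis_succ_left_eq (h : ∀ v < j, ¬ F i v) : lis F (i + 1) j = lis F i j := by
  induction j with
  | zero => simp
  | succ j ih =>
    rw [lis_succ_succ, ih fun v hv => h v (by omega), if_neg (h j (by omega))]
    have := lis_le_succ_right (F := F) i j
    omega

theorem lis_succ_right_eq (h : ∀ u < i, ¬ F u j) : lis F i (j + 1) = lis F i j := by
  rw [← lis_flip (F := F), ← lis_flip (F := F)]; exact lis_succ_left_eq h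

theorem lis_eq_zero (h : ∀ u < i, ∀ v < j, ¬ F u v) : lis F i j = 0 := by
  induction i with
  | zero => simp
  | succ i ih =>
    rw [lis_succ_left_eq fun v hv => h i (by omega) v hv]
    exact ih fun u hu => h u (by omega)

theorem lis_succ_succ_of_not (h : ¬ F i j) :
    lis F (i + 1) (j + 1) = max (lis F (i + 1) j) (lis F i (j + 1)) := by
  rw [lis_succ_succ, if_neg h]; omega

theorem IsPartialPerm.lis_of_mem (hF : IsPartialPerm F) (h : F i j) :
    lis F (i + 1) j = lis F i j ∧ lis F i (j + 1) = lis F i j ∧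
      lis F (i + 1) (j + 1) = lis F i j + 1 := by
  have h1 : lis F (i + 1) j = lis F i j :=
    lis_succ_left_eq fun v hv h' => by have := hF.1 _ _ _ h h'; omega
  have h2 : lis F i (j + 1) = lis F i j :=
    lis_succ_right_eq fun v hv h' => by have := hF.2 _ _ _ h h'; omega
  refine ⟨h1, h2, ?_⟩
  rw [lis_succ_succ, if_pos h]
  omega

/-- Going up column `i`, the difference of `lis` across the column starts at 0, rises to 1 at the
marked cell, and falls back to 0 for good at the skeleton cell. So a column has at most one skeleton
cell, which lies above a marked one. -/
theorem IsPartialPerm.column_invariant (hF : IsPartialPerm F) (i j : ℕ) :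
    (lis F (i + 1) j = lis F i j + 1 ∧ (∃ v < j, F i v) ∧ ∀ v < j, ¬ skel F i v) ∨
    (lis F (i + 1) j = lis F i j ∧ (∃ v < j, F i v) ∧ ∃ v < j, skel F i v) ∨
    (lis F (i + 1) j = lis F i j ∧ (∀ v < j, ¬ F i v) ∧ ∀ v < j, ¬ skel F i v) := by
  induction j with
  | zero => simp
  | succ j ih =>
    simp only [Nat.exists_lt_succ_right, Nat.forall_lt_succ_right]
    by_cases h : F i j
    · obtain ⟨h1, h2, h3⟩ := hF.lis_of_mem h
      have hs : ¬ skel F i j := fun hs => hs.1 h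
      have hn : ∀ v < j, ¬ F i v := fun v hv h' => by have := hF.1 _ _ _ h h'; omega
      rcases ih with h' | h' | h'
      · obtain ⟨v, hv, h'⟩ := h'.2.1; exact absurd h' (hn v hv)
      · obtain ⟨v, hv, h'⟩ := h'.2.1; exact absurd h' (hn v hv)
      · left; exact ⟨by omega, Or.inr h, h'.2.2, hs⟩
    · have hd := lis_succ_succ_of_not h
      have := lis_le_succ_right (F := F) i j
      have := lis_succ_right_le (F := F) i j
      by_cases hs : skel F i j
      · obtain ⟨-, h1, h2⟩ := hs
        rcases ih with h' | h' | h'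
        · right; left; exact ⟨by omega, Or.inl h'.2.1, Or.inr ⟨h, h1, h2⟩⟩
        · omega
        · omega
      · have hs' : ¬ (lis F i (j + 1) = lis F i j + 1 ∧ lis F (i + 1) j = lis F i j + 1) :=
          fun h' => hs ⟨h, h'⟩
        rcases ih with h' | h' | h'
        · left; exact ⟨by omega, Or.inl h'.2.1, h'.2.2, hs⟩
        · right; left; exact ⟨by omega, Or.inl h'.2.1, Or.inl h'.2.2⟩
        · right; right; exact ⟨by omega, ⟨h'.2.1, h⟩, h'.2.2, hs⟩

theorem IsPartialPerm.of_skel (hF : IsPartialPerm F) (h : skel F i j) :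
    (∃ v < j, F i v) ∧ ∀ v < j, ¬ skel F i v := by
  have := h.2.2
  rcases hF.column_invariant i j with h' | h' | h'
  · exact h'.2
  · omega
  · omega

theorem IsPartialPerm.of_skel' (hF : IsPartialPerm F) (h : skel F i j) :
    (∃ u < i, F u j) ∧ ∀ u < i, ¬ skel F u j := by
  have h' : skel (_root_.flip F) j i := by rw [skel_flip]; exact h
  have := hF.flip.of_skel h'
  rwa [skel_flip] at this

theorem IsPartialPerm.skel (hF : IsPartialPerm F) : IsPartialPerm (skel F) := by
  constructor
  · intro u v v' h h'
    rcases lt_trichotomy v v' with hv | hv | hv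
    · exact absurd h ((hF.of_skel h').2 v hv)
    · exact hv
    · exact absurd h' ((hF.of_skel h).2 v' hv)
  · intro u u' v h h'
    rcases lt_trichotomy u u' with hv | hv | hv
    · exact absurd h ((hF.of_skel' h').2 u hv)
    · exact hv
    · exact absurd h' ((hF.of_skel' h).2 u' hv)

theorem IsPartialPerm.skel_iterate (hF : IsPartialPerm F) (r : ℕ) :
    IsPartialPerm (_root_.skel^[r] F) := by
  induction r with
  | zero => exact hF
  | succ r ih => rw [Function.iterate_succ_apply']; exact ih.skel

theorem skel_iterate_flip (r : ℕ) : skel^[r] (flip F) = flip (skel^[r] F) := by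
  induction r with
  | zero => rfl
  | succ r ih => rw [Function.iterate_succ_apply', Function.iterate_succ_apply', ih, skel_flip]

/-- If there is a cell of the filling before `(i, j)` in column `i` and in row `j`, but no cell of
the skeleton, then `(i, j)` belongs to the skeleton. -/
theorem IsPartialPerm.skel_of (hF : IsPartialPerm F) {u v : ℕ} (hv : v < j) (hiv : F i v)
    (hu : u < i) (huj : F u j) (h1 : ∀ v < j, ¬ _root_.skel F i v)
    (h2 : ∀ u < i, ¬ _root_.skel F u j) : _root_.skel F i j := by
  refine ⟨fun h => ?_, ?_, ?_⟩
  · have := hF.1 _ _ _ h hiv; omega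
  · have := hF.flip.column_invariant j i
    rw [skel_flip, lis_flip, lis_flip] at this
    rcases this with h | h | h
    · exact h.1
    · obtain ⟨x, hx, h⟩ := h.2.2; exact absurd h (h2 x hx)
    · exact absurd huj (h.2.1 u hu)
  · rcases hF.column_invariant i j with h | h | h
    · exact h.1
    · obtain ⟨x, hx, h⟩ := h.2.2; exact absurd h (h1 x hx)
    · exact absurd hiv (h.2.1 v hv)

/-- Between two cells of the skeleton that form a decreasing chain there is a marked cell. -/
theorem IsPartialPerm.exists_mem_between (hF : IsPartialPerm F) {u v u' v' : ℕ} (hu : u' < u)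
    (hv : v < v') (h : _root_.skel F u v) (h' : _root_.skel F u' v') :
    ∃ s t, u' ≤ s ∧ s < u ∧ v ≤ t ∧ t < v' ∧ F s t := by
  obtain ⟨⟨t, ht, hFt⟩, ht'⟩ := hF.of_skel h'
  obtain ⟨⟨s, hs, hFs⟩, hs'⟩ := hF.of_skel' h
  by_cases htv : v ≤ t
  · exact ⟨u', t, le_rfl, hu, htv, ht, hFt⟩
  by_cases hsu : u' ≤ s
  · exact ⟨s, v, hsu, hs, le_rfl, hv, hFs⟩
  push Not at htv hsu
  -- Otherwise `(u', t)` and `(s, v)` force a skeleton cell at `(u', v)`, although column `u'`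
  -- already has the skeleton cell `(u', v')`.
  exact absurd (hF.skel_of htv hFt hsu hFs (fun x hx => ht' x (by omega))
    fun x hx => hs' x (by omega)) (ht' v hv)

/-- Between two marked cells that form a decreasing chain there is a cell of the skeleton. -/
theorem IsPartialPerm.exists_skel_between (hF : IsPartialPerm F) {u v u' v' : ℕ} (hu : u' < u)
    (hv : v < v') (h : F u v) (h' : F u' v') :
    ∃ s t, u' < s ∧ s ≤ u ∧ v < t ∧ t ≤ v' ∧ _root_.skel F s t := by
  by_cases h1 : ∃ t < v', _root_.skel F u t
  · obtain ⟨t, ht, hs⟩ := h1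
    obtain ⟨⟨y, hy, hFy⟩, -⟩ := hF.of_skel hs
    have := hF.1 _ _ _ h hFy
    exact ⟨u, t, hu, le_rfl, by omega, ht.le, hs⟩
  by_cases h2 : ∃ s < u, _root_.skel F s v'
  · obtain ⟨s, hs, hs'⟩ := h2
    obtain ⟨⟨y, hy, hFy⟩, -⟩ := hF.of_skel' hs'
    have := hF.2 _ _ _ h' hFy
    exact ⟨s, v', by omega, hs.le, hv, le_rfl, hs'⟩
  push Not at h1 h2
  exact ⟨u, v', hu, le_rfl, hv, le_rfl, hF.skel_of hv h hu h' h1 h2⟩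

theorem lis_congr (h : ∀ u < i, ∀ v < j, F u v ↔ G u v) : lis F i j = lis G i j := by
  induction i generalizing j with
  | zero => simp
  | succ i ih =>
    induction j with
    | zero => simp
    | succ j ihj =>
      rw [lis_succ_succ, lis_succ_succ, ihj fun u hu v hv => h u hu v (by omega),
        ih fun u hu v hv => h u (by omega) v hv,
        ih fun u hu v hv => h u (by omega) v (by omega)]
      have e : F i j ↔ G i j := h i (by omega) j (by omega)
      by_cases hG : G i j
      · rw [if_pos hG, if_pos (e.2 hG)]
      · rw [if_neg hG, if_neg (mt e.1 hG)]

theorem skel_congr (h : ∀ u < i, ∀ v < j, F u v ↔ G u v) :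
    ∀ u < i, ∀ v < j, skel F u v ↔ skel G u v := by
  intro u hu v hv
  rw [skel, skel, h u hu v hv, lis_congr fun x hx y hy => h x (by omega) y (by omega),
    lis_congr fun x hx y hy => h x (by omega) y (by omega),
    lis_congr fun x hx y hy => h x (by omega) y (by omega)]

theorem skel_iterate_congr (h : ∀ u < i, ∀ v < j, F u v ↔ G u v) (r : ℕ) :
    ∀ u < i, ∀ v < j, skel^[r] F u v ↔ skel^[r] G u v := by
  induction r with
  | zero => exact h
  | succ r ih =>
    intro u hu v hv
    rw [Function.iterate_succ_apply', Function.iterate_succ_apply']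
    exact skel_congr ih u hu v hv

theorem IsPartialPerm.exists_of_skel_iterate (hF : IsPartialPerm F) {r s : ℕ} (hrs : r ≤ s)
    (h : ∃ v < j, _root_.skel^[s] F i v) : ∃ v < j, _root_.skel^[r] F i v := by
  induction s, hrs using Nat.le_induction with
  | base => exact h
  | succ s _ ih =>
    obtain ⟨v, hv, h⟩ := h
    rw [Function.iterate_succ_apply'] at h
    obtain ⟨⟨w, hw, h⟩, -⟩ := (hF.skel_iterate s).of_skel h
    exact ih ⟨w, by omega, h⟩

/-- A skeleton cell has a marked cell strictly to its left in the same row, so each iteration moves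
at least one column to the right. This makes the labels finite and lets inductions on `r` run
downwards. -/
theorem IsPartialPerm.le_of_skel_iterate (hF : IsPartialPerm F) {r : ℕ}
    (h : _root_.skel^[r] F i j) : r ≤ i := by
  induction r generalizing i with
  | zero => omega
  | succ r ih =>
    rw [Function.iterate_succ_apply'] at h
    obtain ⟨⟨w, hw, h⟩, -⟩ := (hF.skel_iterate r).of_skel' h
    have := ih h
    omega

theorem IsPartialPerm.lis_skel_iterate_eq_zero (hF : IsPartialPerm F) {r : ℕ} (h : i ≤ r) :
    lis (_root_.skel^[r] F) i j = 0 :=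
  lis_eq_zero fun u hu v _ h' => by have := hF.le_of_skel_iterate h'; omega

theorem lis_skel_le (i j : ℕ) :
    lis (skel F) i j ≤ lis F i j := by
  induction i generalizing j with
  | zero => simp
  | succ i ih =>
    induction j with
    | zero => simp
    | succ j ihj =>
      have h1 := lis_le_succ_left (F := F) i (j + 1)
      have h2 := lis_le_succ_right (F := F) (i + 1) j
      have h3 := ih j
      have h4 := ih (j + 1)
      rw [lis_succ_succ]
      split_ifs with hs
      · obtain ⟨h, h5, h6⟩ := hs
        omega
      · omega

/-- A column occupied before row `j` changes exactly one of the numbers `lis (skel^[r] F) · j`. -/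
theorem IsPartialPerm.exists_lis_ne_iff (hF : IsPartialPerm F) :
    (∃ r, lis (_root_.skel^[r] F) (i + 1) j ≠ lis (_root_.skel^[r] F) i j) ↔ ∃ v < j, F i v := by
  constructor
  · rintro ⟨r, hr⟩
    refine hF.exists_of_skel_iterate (Nat.zero_le r) ?_
    by_contra! h
    exact hr (lis_succ_left_eq h)
  · intro h
    by_contra! hr
    -- If no iterate changes across the column, the column invariant passes an occupied cell from
    -- each skeleton to the next, which cannot go on beyond `r = i`.
    have key : ∀ r, ∃ v < j, _root_.skel^[r] F i v := by
      intro r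
      induction r with
      | zero => exact h
      | succ r ih =>
        rw [Function.iterate_succ_apply']
        rcases (hF.skel_iterate r).column_invariant i j with h' | h' | h'
        · have := hr r; omega
        · exact h'.2.2
        · obtain ⟨v, hv, ih⟩ := ih
          exact absurd ih (h'.2.1 v hv)
    obtain ⟨v, -, h⟩ := key (i + 1)
    have := hF.le_of_skel_iterate h
    omega

theorem IsPartialPerm.lis_ne_unique (hF : IsPartialPerm F) {r s : ℕ}
    (hr : lis (_root_.skel^[r] F) (i + 1) j ≠ lis (_root_.skel^[r] F) i j)
    (hs : lis (_root_.skel^[s] F) (i + 1) j ≠ lis (_root_.skel^[s] F) i j) : r = s := by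
  wlog hrs : r < s generalizing r s
  · rcases Nat.lt_or_ge s r with h | h
    · exact (this hs hr h).symm
    · omega
  exfalso
  have h1 : ∃ v < j, _root_.skel^[s] F i v := by
    by_contra! h
    exact hs (lis_succ_left_eq h)
  -- A change at the later index `s` needs a cell of `skel^[s]`, hence one of `skel^[r + 1]`, in the
  -- column below `j`; that cell has already cancelled the change at `r`.
  obtain ⟨v, hv, h⟩ := hF.exists_of_skel_iterate (Nat.succ_le_of_lt hrs) h1
  rw [Function.iterate_succ_apply'] at h
  rcases (hF.skel_iterate r).column_invariant i j with h' | h' | h'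
  · exact h'.2.2 v hv h
  · exact hr h'.1
  · exact hr h'.1

/-- The label of the lower left corner of a cell, and the cell itself, are determined by the labels
of the other three corners. -/
theorem IsPartialPerm.local_unique (hF : IsPartialPerm F) (hG : IsPartialPerm G)
    (h1 : ∀ r, lis (_root_.skel^[r] F) (i + 1) j = lis (_root_.skel^[r] G) (i + 1) j)
    (h2 : ∀ r, lis (_root_.skel^[r] F) i (j + 1) = lis (_root_.skel^[r] G) i (j + 1))
    (h3 : ∀ r, lis (_root_.skel^[r] F) (i + 1) (j + 1) = lis (_root_.skel^[r] G) (i + 1) (j + 1))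
    (r : ℕ) : (_root_.skel^[r] F i j ↔ _root_.skel^[r] G i j) ∧
      lis (_root_.skel^[r] F) i j = lis (_root_.skel^[r] G) i j := by
  -- Downward induction on `r`, starting where column `i` has no cells left.
  induction hd : i + 1 - r generalizing r with
  | zero =>
    have hr : i ≤ r := by omega
    constructor
    · constructor <;> intro h
      · have := hF.le_of_skel_iterate h; omega
      · have := hG.le_of_skel_iterate h; omega
    · rw [hF.lis_skel_iterate_eq_zero hr, hG.lis_skel_iterate_eq_zero hr]
  | succ d ih =>
    -- A marked cell is visible as an upper right value exceeding both neighbours. For an unmarked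
    -- cell the lower left value is the smaller neighbour, less one exactly when the cell lies in
    -- the next skeleton, which is known by induction.
    have ih' := (ih (r + 1) (by omega)).1
    rw [Function.iterate_succ_apply', Function.iterate_succ_apply'] at ih'
    have e1 := h1 r
    have e2 := h2 r
    have e3 := h3 r
    have PF := hF.skel_iterate r
    have PG := hG.skel_iterate r
    generalize _root_.skel^[r] F = F' at *
    generalize _root_.skel^[r] G = G' at *
    have a1 := lis_le_succ_left (F := F') i j
    have a2 := lis_le_succ_right (F := F') i j
    have a3 := lis_succ_left_le (F := F') i j
    have a4 := lis_succ_right_le (F := F') i j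
    have b1 := lis_le_succ_left (F := G') i j
    have b2 := lis_le_succ_right (F := G') i j
    have b3 := lis_succ_left_le (F := G') i j
    have b4 := lis_succ_right_le (F := G') i j
    by_cases hf : F' i j <;> by_cases hg : G' i j
    · have := PF.lis_of_mem hf
      have := PG.lis_of_mem hg
      simp only [hf, hg, true_and]; omega
    · have := PF.lis_of_mem hf
      have := lis_succ_succ_of_not hg
      omega
    · have := PG.lis_of_mem hg
      have := lis_succ_succ_of_not hf
      omega
    · have := lis_succ_succ_of_not hf
      have := lis_succ_succ_of_not hg
      simp only [_root_.skel, hf, hg, not_false_eq_true, true_and] at ih' ⊢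
      omega

end lis

/-! ### Chains -/

theorem exists_chain_succ {α : Type*} (P : α → Prop) (R : α → α → Prop) (k : ℕ) :
    (∃ f : Fin (k + 1) → α, (∀ a, P (f a)) ∧ ∀ a b, a < b → R (f a) (f b)) ↔
      ∃ x, P x ∧ ∃ f : Fin k → α, (∀ a, P (f a) ∧ R (f a) x) ∧ ∀ a b, a < b → R (f a) (f b) := by
  constructor
  · rintro ⟨f, hP, hR⟩
    exact ⟨f (Fin.last k), hP _, fun a => f a.castSucc,
      fun a => ⟨hP _, hR _ _ (Fin.castSucc_lt_last a)⟩,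
      fun a b hab => hR _ _ (Fin.castSucc_lt_castSucc_iff.2 hab)⟩
  · rintro ⟨x, hx, f, hf, hR⟩
    refine ⟨Fin.snoc (α := fun _ => α) f x, fun a => ?_, fun a b hab => ?_⟩
    · refine Fin.lastCases ?_ (fun a => ?_) a
      · simpa using hx
      · simpa using (hf a).1
    · induction b using Fin.lastCases with
      | last =>
        induction a using Fin.lastCases with
        | last => exact absurd hab (lt_irrefl _)
        | cast a => simpa using (hf a).2
      | cast b =>
        induction a using Fin.lastCases with
        | last => exact absurd hab (by simpa using (Fin.castSucc_lt_last b).le)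
        | cast a => simpa using hR a b (Fin.castSucc_lt_castSucc_iff.1 hab)

/-- An increasing chain of `k` marked cells `(u, v)` with `u < i` and `v < j`. -/
def HasIncChain (F : ℕ → ℕ → Prop) (k i j : ℕ) : Prop :=
  ∃ f : Fin k → ℕ × ℕ, (∀ a, (f a).1 < i ∧ (f a).2 < j ∧ F (f a).1 (f a).2) ∧
    ∀ a b, a < b → (f a).1 < (f b).1 ∧ (f a).2 < (f b).2

/-- A decreasing chain of `k` marked cells `(u, v)` with `u < i` and `l ≤ v < j`. -/
def HasDecChain (F : ℕ → ℕ → Prop) (j k i l : ℕ) : Prop :=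
  ∃ f : Fin k → ℕ × ℕ, (∀ a, (f a).1 < i ∧ l ≤ (f a).2 ∧ (f a).2 < j ∧ F (f a).1 (f a).2) ∧
    ∀ a b, a < b → (f a).1 < (f b).1 ∧ (f b).2 < (f a).2

section chains

variable {F : ℕ → ℕ → Prop} {i j k l : ℕ}

theorem hasIncChain_succ : HasIncChain F (k + 1) i j ↔
    ∃ u < i, ∃ v < j, F u v ∧ HasIncChain F k u v := by
  rw [HasIncChain, exists_chain_succ (fun p : ℕ × ℕ => p.1 < i ∧ p.2 < j ∧ F p.1 p.2)
    (fun p q => p.1 < q.1 ∧ p.2 < q.2)]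
  constructor
  · rintro ⟨⟨u, v⟩, ⟨hu, hv, hF⟩, f, hf, hR⟩
    exact ⟨u, hu, v, hv, hF, f, fun a => ⟨(hf a).2.1, (hf a).2.2, (hf a).1.2.2⟩, hR⟩
  · rintro ⟨u, hu, v, hv, hF, f, hf, hR⟩
    exact ⟨⟨u, v⟩, ⟨hu, hv, hF⟩, f, fun a => ⟨⟨(hf a).1.trans hu, (hf a).2.1.trans hv,
      (hf a).2.2⟩, (hf a).1, (hf a).2.1⟩, hR⟩

theorem hasDecChain_succ : HasDecChain F j (k + 1) i l ↔
    ∃ u < i, ∃ v, l ≤ v ∧ v < j ∧ F u v ∧ HasDecChain F j k u (v + 1) := by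
  rw [HasDecChain, exists_chain_succ
    (fun p : ℕ × ℕ => p.1 < i ∧ l ≤ p.2 ∧ p.2 < j ∧ F p.1 p.2)
    (fun p q => p.1 < q.1 ∧ q.2 < p.2)]
  constructor
  · rintro ⟨⟨u, v⟩, ⟨hu, hl, hv, hF⟩, f, hf, hR⟩
    exact ⟨u, hu, v, hl, hv, hF, f, fun a => ⟨(hf a).2.1, (hf a).2.2, (hf a).1.2.2⟩, hR⟩
  · rintro ⟨u, hu, v, hl, hv, hF, f, hf, hR⟩
    refine ⟨⟨u, v⟩, ⟨hu, hl, hv, hF⟩, f, fun a => ⟨⟨(hf a).1.trans hu, ?_, (hf a).2.2⟩,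
      (hf a).1, (hf a).2.1⟩, hR⟩
    have := (hf a).2.1
    omega

theorem HasIncChain.zero : HasIncChain F 0 i j := ⟨Fin.elim0, fun a => a.elim0, fun a => a.elim0⟩

theorem HasDecChain.zero : HasDecChain F j 0 i l :=
  ⟨Fin.elim0, fun a => a.elim0, fun a => a.elim0⟩

theorem HasIncChain.mono {i' j' : ℕ} (h : HasIncChain F k i j) (hi : i ≤ i') (hj : j ≤ j') :
    HasIncChain F k i' j' := by
  obtain ⟨f, hf, hR⟩ := h
  exact ⟨f, fun a => ⟨(hf a).1.trans_le hi, (hf a).2.1.trans_le hj, (hf a).2.2⟩, hR⟩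

theorem HasDecChain.mono {i' l' : ℕ} (h : HasDecChain F j k i l) (hi : i ≤ i') (hl : l' ≤ l) :
    HasDecChain F j k i' l' := by
  obtain ⟨f, hf, hR⟩ := h
  exact ⟨f, fun a => ⟨(hf a).1.trans_le hi, hl.trans (hf a).2.1, (hf a).2.2⟩, hR⟩

theorem le_lis_iff : k ≤ lis F i j ↔ HasIncChain F k i j := by
  induction k generalizing i j with
  | zero => exact iff_of_true (Nat.zero_le _) HasIncChain.zero
  | succ k ih =>
    constructor
    · intro h
      induction i generalizing j with
      | zero => simp at h
      | succ i ihi =>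
        induction j with
        | zero => simp at h
        | succ j ihj =>
          rw [lis_succ_succ, le_max_iff, le_max_iff] at h
          rcases h with (h | h) | h
          · exact (ihj h).mono le_rfl (Nat.le_succ j)
          · exact (ihi h).mono (Nat.le_succ i) le_rfl
          · split_ifs at h with hF
            · exact hasIncChain_succ.2 ⟨i, Nat.lt_succ_self i, j, Nat.lt_succ_self j, hF,
                ih.1 (Nat.le_of_succ_le_succ h)⟩
            · omega
    · intro h
      obtain ⟨u, hu, v, hv, hF, h⟩ := hasIncChain_succ.1 h
      refine le_trans ?_ (lis_mono (F := F) (Nat.succ_le_of_lt hu) (Nat.succ_le_of_lt hv))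
      rw [Nat.succ_eq_add_one, Nat.succ_eq_add_one, lis_succ_succ, if_pos hF]
      exact le_max_of_le_right (Nat.succ_le_succ (ih.2 h))

/-- Each gap between consecutive marked cells of the chain, the last being `(u, v)`, contributes one
skeleton cell. -/
theorem IsPartialPerm.hasDecChain_skel_of_mem (hF : IsPartialPerm F) {u v : ℕ} (huv : F u v)
    (h : HasDecChain F j k u (v + 1)) : HasDecChain (_root_.skel F) j k (u + 1) (v + 1) := by
  induction k generalizing u v with
  | zero => exact HasDecChain.zero
  | succ k ih =>
    obtain ⟨u', hu', v', hl, hv', huv', h⟩ := hasDecChain_succ.1 h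
    obtain ⟨s, t, h1, h2, h3, h4, hs⟩ := hF.exists_skel_between hu' hl huv huv'
    exact hasDecChain_succ.2 ⟨s, by omega, t, by omega, by omega, hs,
      (ih huv' h).mono (by omega) (by omega)⟩

/-- The gaps between skeleton cells contribute marked cells, and the upper left end of the chain
contributes one more, to the left of it in its row. The marked cell under the lower right end is
added in `hasDecChain_skel_iff`. -/
theorem IsPartialPerm.hasDecChain_of_skel (hF : IsPartialPerm F) {u v : ℕ}
    (huv : _root_.skel F u v) (hv : v < j) (h : HasDecChain (_root_.skel F) j k u (v + 1)) :
    HasDecChain F j (k + 1) u v := by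
  induction k generalizing u v with
  | zero =>
    obtain ⟨s, hs, hFs⟩ := (hF.of_skel' huv).1
    exact hasDecChain_succ.2 ⟨s, hs, v, le_rfl, hv, hFs, HasDecChain.zero⟩
  | succ k ih =>
    obtain ⟨u', hu', v', hl, hv', huv', h⟩ := hasDecChain_succ.1 h
    obtain ⟨s, t, h1, h2, h3, h4, hs⟩ := hF.exists_mem_between hu' hl huv huv'
    exact hasDecChain_succ.2 ⟨s, h2, t, h3, by omega, hs, (ih huv' hv' h).mono h1 h4⟩

theorem IsPartialPerm.hasDecChain_skel_iff (hF : IsPartialPerm F) :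
    HasDecChain (_root_.skel F) j (k + 1) i 0 ↔ HasDecChain F j (k + 2) i 0 := by
  constructor
  · intro h
    obtain ⟨u, hu, v, -, hv, huv, h⟩ := hasDecChain_succ.1 h
    obtain ⟨t, ht, hFt⟩ := (hF.of_skel huv).1
    exact hasDecChain_succ.2 ⟨u, hu, t, Nat.zero_le t, by omega, hFt,
      (hF.hasDecChain_of_skel huv hv h).mono le_rfl ht⟩
  · intro h
    obtain ⟨u, hu, v, -, hv, huv, h⟩ := hasDecChain_succ.1 h
    exact (hF.hasDecChain_skel_of_mem huv h).mono hu (Nat.zero_le _)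

theorem IsPartialPerm.lis_skel_iterate_pos_iff (hF : IsPartialPerm F) :
    0 < lis (_root_.skel^[k] F) i j ↔ HasDecChain F j (k + 1) i 0 := by
  induction k generalizing F with
  | zero =>
    rw [Function.iterate_zero_apply, hasDecChain_succ, ← Nat.succ_le_iff, Nat.succ_eq_add_one,
      le_lis_iff, hasIncChain_succ]
    simp [HasIncChain.zero, HasDecChain.zero]
  | succ k ih => rw [Function.iterate_succ_apply, ih hF.skel, hF.hasDecChain_skel_iff]

end chains

/-! ### The growth diagram of a filling -/

namespace YoungDiagram

/-- `Step μ ν`: the diagram `ν` is equal to `μ` or has one more cell. -/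
def Step (μ ν : YoungDiagram) : Prop :=
  μ ≤ ν ∧ (ν.cells \ μ.cells).card ≤ 1

theorem ext_rowLen {μ ν : YoungDiagram} (h : ∀ r, μ.rowLen r = ν.rowLen r) : μ = ν := by
  refine SetLike.ext fun c => ?_
  rw [show c = (c.1, c.2) from rfl, mem_iff_lt_rowLen, mem_iff_lt_rowLen, h]

theorem Step.refl (μ : YoungDiagram) : Step μ μ := ⟨le_rfl, by simp⟩

theorem Step.transpose {μ ν : YoungDiagram} (h : Step μ ν) : Step μ.transpose ν.transpose := by
  refine ⟨YoungDiagram.transpose_mono h.1, ?_⟩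
  rw [Finset.card_le_one] at *
  rintro ⟨a, b⟩ hab ⟨c, d⟩ hcd
  have := h.2
  rw [Finset.card_le_one] at this
  have := this (b, a) (by simpa using hab) (d, c) (by simpa using hcd)
  simp only [Prod.mk.injEq] at this ⊢
  exact this.symm

theorem rowLen_mono {μ ν : YoungDiagram} (h : μ ≤ ν) (r : ℕ) : μ.rowLen r ≤ ν.rowLen r := by
  by_contra! h'
  have := h (mem_iff_lt_rowLen.2 h')
  exact absurd (mem_iff_lt_rowLen.1 this) (lt_irrefl _)

theorem rowLen_inf (μ ν : YoungDiagram) (r : ℕ) :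
    (μ ⊓ ν).rowLen r = min (μ.rowLen r) (ν.rowLen r) := by
  refine eq_of_forall_lt_iff fun c => ?_
  rw [← mem_iff_lt_rowLen, mem_inf, mem_iff_lt_rowLen, mem_iff_lt_rowLen, lt_min_iff]

theorem step_of_rowLen {μ ν : YoungDiagram} {r : ℕ}
    (h : ∀ s, ν.rowLen s = μ.rowLen s + if s = r then 1 else 0) : Step μ ν := by
  constructor
  · rintro ⟨a, b⟩ hab
    change (a, b) ∈ μ at hab
    rw [mem_iff_lt_rowLen] at *
    have := h a
    omega
  · rw [Finset.card_le_one]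
    have key : ∀ p ∈ ν.cells \ μ.cells, p = (r, μ.rowLen r) := by
      rintro ⟨a, b⟩ hab
      rw [Finset.mem_sdiff, mem_cells, mem_cells, mem_iff_lt_rowLen, mem_iff_lt_rowLen] at hab
      have := h a
      split_ifs at this with har
      · subst har
        exact Prod.ext rfl (show b = _ by omega)
      · omega
    intro p hp q hq
    rw [key p hp, key q hq]

theorem Step.rowLen {μ ν : YoungDiagram} (h : Step μ ν) :
    ν = μ ∨ ∃ r, ∀ s, ν.rowLen s = μ.rowLen s + if s = r then 1 else 0 := by
  obtain ⟨hle, hc⟩ := h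
  rw [Finset.card_le_one] at hc
  by_cases he : ∃ r, μ.rowLen r < ν.rowLen r
  · obtain ⟨r, hr⟩ := he
    right
    refine ⟨r, fun s => ?_⟩
    have key : ∀ s x, μ.rowLen s ≤ x → x < ν.rowLen s → s = r ∧ x = μ.rowLen r := by
      intro s x h1 h2
      have := hc (s, x) (by
        rw [Finset.mem_sdiff, mem_cells, mem_cells, mem_iff_lt_rowLen, mem_iff_lt_rowLen]
        omega) (r, μ.rowLen r) (by
        rw [Finset.mem_sdiff, mem_cells, mem_cells, mem_iff_lt_rowLen, mem_iff_lt_rowLen]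
        omega)
      simpa using this
    have hs := rowLen_mono hle s
    split_ifs with hsr
    · subst hsr
      by_contra hne
      have := (key s (μ.rowLen s + 1) (by omega) (by omega)).2
      omega
    · by_contra hne
      exact hsr (key s (μ.rowLen s) le_rfl (by omega)).1
  · left
    push Not at he
    exact ext_rowLen fun r => le_antisymm (he r) (rowLen_mono hle r)

/-- The Young diagram with given row lengths. -/
noncomputable def ofRows (f : ℕ → ℕ) (hf : Antitone f) (N : ℕ) (_hN : f N = 0) : YoungDiagram where
  cells := (Finset.range N).biUnion fun r => {r} ×ˢ Finset.range (f r)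
  isLowerSet := by
    rintro ⟨a, b⟩ ⟨c, d⟩ hle hab
    obtain ⟨h1, h2⟩ := Prod.mk_le_mk.1 hle
    simp only [Finset.coe_biUnion, Set.mem_iUnion, Finset.mem_coe, Finset.mem_range,
      Finset.mem_product, Finset.mem_singleton] at hab ⊢
    obtain ⟨r, hr, rfl, hb⟩ := hab
    have := hf h1
    exact ⟨c, by omega, rfl, by omega⟩

theorem rowLen_ofRows {f : ℕ → ℕ} {hf : Antitone f} {N : ℕ} {hN : f N = 0} (r : ℕ) :
    (ofRows f hf N hN).rowLen r = f r := by
  refine eq_of_forall_lt_iff fun c => ?_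
  rw [← mem_iff_lt_rowLen, ← mem_cells]
  simp only [ofRows, Finset.mem_biUnion, Finset.mem_range, Finset.mem_product,
    Finset.mem_singleton]
  constructor
  · rintro ⟨r', -, rfl, h⟩; exact h
  · intro h
    refine ⟨r, ?_, rfl, h⟩
    by_contra! hr
    have := hf hr
    omega

end YoungDiagram

open YoungDiagram

/-! ### Corner labels and Fomin's local rule -/

theorem antitone_lis_skel (F : ℕ → ℕ → Prop) (i j : ℕ) :
    Antitone fun r => lis (skel^[r] F) i j :=
  antitone_nat_of_succ_le fun r => by
    rw [Function.iterate_succ_apply']; exact lis_skel_le i j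

open Classical in
/-- The label of the corner `(i, j)` in the growth diagram of a filling. -/
noncomputable def label (F : ℕ → ℕ → Prop) (i j : ℕ) : YoungDiagram :=
  if hF : IsPartialPerm F then
    ofRows (fun r => lis (skel^[r] F) i j) (antitone_lis_skel F i j) i
      (hF.lis_skel_iterate_eq_zero le_rfl)
  else ⊥

section label

variable {F G : ℕ → ℕ → Prop} {i j : ℕ}

theorem IsPartialPerm.rowLen_label (hF : IsPartialPerm F) (i j r : ℕ) :
    (label F i j).rowLen r = lis (_root_.skel^[r] F) i j := by
  rw [label, dif_pos hF, rowLen_ofRows]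

theorem IsPartialPerm.label_flip (hF : IsPartialPerm F) (i j : ℕ) :
    label (_root_.flip F) i j = label F j i :=
  ext_rowLen fun r => by
    rw [hF.flip.rowLen_label, hF.rowLen_label, skel_iterate_flip, lis_flip]

theorem IsPartialPerm.step_label_left (hF : IsPartialPerm F) (i j : ℕ) :
    Step (label F i j) (label F (i + 1) j) := by
  by_cases h : ∃ r, lis (_root_.skel^[r] F) (i + 1) j ≠ lis (_root_.skel^[r] F) i j
  · obtain ⟨r, hr⟩ := h
    refine step_of_rowLen (r := r) fun s => ?_
    rw [hF.rowLen_label, hF.rowLen_label]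
    split_ifs with hs
    · subst hs
      have := lis_le_succ_left (F := _root_.skel^[s] F) i j
      have := lis_succ_left_le (F := _root_.skel^[s] F) i j
      omega
    · by_contra hne
      exact hs (hF.lis_ne_unique hne hr)
  · push Not at h
    rw [ext_rowLen (μ := label F (i + 1) j) (ν := label F i j) fun r => by
      rw [hF.rowLen_label, hF.rowLen_label, h]]
    exact Step.refl _

theorem IsPartialPerm.step_label_right (hF : IsPartialPerm F) (i j : ℕ) :
    Step (label F i j) (label F i (j + 1)) := by
  rw [← hF.label_flip, ← hF.label_flip]
  exact hF.flip.step_label_left j i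

theorem IsPartialPerm.label_left_ne_iff (hF : IsPartialPerm F) :
    label F (i + 1) j ≠ label F i j ↔ ∃ v < j, F i v := by
  rw [← hF.exists_lis_ne_iff]
  constructor
  · intro h
    by_contra! h'
    exact h (ext_rowLen fun r => by rw [hF.rowLen_label, hF.rowLen_label, h'])
  · rintro ⟨r, hr⟩ h
    rw [← hF.rowLen_label, ← hF.rowLen_label, h] at hr
    exact hr rfl

theorem IsPartialPerm.label_right_ne_iff (hF : IsPartialPerm F) :
    label F i (j + 1) ≠ label F i j ↔ ∃ u < i, F u j := by
  rw [← hF.label_flip, ← hF.label_flip, hF.flip.label_left_ne_iff]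
  rfl

theorem IsPartialPerm.label_zero_left (hF : IsPartialPerm F) (j : ℕ) : label F 0 j = ⊥ := by
  refine SetLike.ext fun c => ?_
  rw [show c = (c.1, c.2) from rfl, mem_iff_lt_rowLen, hF.rowLen_label]
  simp

theorem IsPartialPerm.label_zero_right (hF : IsPartialPerm F) (i : ℕ) : label F i 0 = ⊥ := by
  rw [← hF.label_flip, hF.flip.label_zero_left]

theorem IsPartialPerm.label_congr (hF : IsPartialPerm F) (hG : IsPartialPerm G)
    (h : ∀ u < i, ∀ v < j, F u v ↔ G u v) : label F i j = label G i j :=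
  ext_rowLen fun r => by
    rw [hF.rowLen_label, hG.rowLen_label, lis_congr (skel_iterate_congr h r)]

/-- The filling in the staircase `u + v + 2 ≤ N` is determined by the labels on its boundary. -/
theorem IsPartialPerm.eq_of_label_eq (hF : IsPartialPerm F) (hG : IsPartialPerm G) {N : ℕ}
    (hF' : ∀ u v, F u v → u + v + 2 ≤ N) (hG' : ∀ u v, G u v → u + v + 2 ≤ N)
    (h : ∀ u v, u + v = N ∨ u + v + 1 = N → label F u v = label G u v) : F = G := by
  -- The labels are recovered inwards from the boundary; `d` is the distance to the outer
  -- antidiagonal.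
  have key : ∀ d u v, u + v + d = N → label F u v = label G u v := by
    intro d
    induction d using Nat.strong_induction_on with
    | _ d ih =>
      intro u v huv
      rcases Nat.lt_or_ge d 2 with hd | hd
      · exact h u v (by omega)
      · have h1 := ih (d - 1) (by omega) (u + 1) v (by omega)
        have h2 := ih (d - 1) (by omega) u (v + 1) (by omega)
        have h3 := ih (d - 2) (by omega) (u + 1) (v + 1) (by omega)
        refine ext_rowLen fun r => ?_
        rw [hF.rowLen_label, hG.rowLen_label]
        refine (hF.local_unique hG ?_ ?_ ?_ r).2 <;> intro r <;>
          rw [← hF.rowLen_label, ← hG.rowLen_label]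
        · rw [h1]
        · rw [h2]
        · rw [h3]
  funext u v
  refine propext ?_
  by_cases huv : u + v + 2 ≤ N
  · refine (hF.local_unique hG ?_ ?_ ?_ 0).1 <;> intro r <;>
      rw [← hF.rowLen_label, ← hG.rowLen_label]
    · rw [key (N - (u + 1 + v)) (u + 1) v (by omega)]
    · rw [key (N - (u + (v + 1))) u (v + 1) (by omega)]
    · rw [key (N - (u + 1 + (v + 1))) (u + 1) (v + 1) (by omega)]
  · exact iff_of_false (fun h => huv (hF' _ _ h)) fun h => huv (hG' _ _ h)

/-- Fomin's local rule for the labels of the four corners of a cell, `X` saying that the cell is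
marked. -/
def LocalRule (l m n p : YoungDiagram) (X : Prop) : Prop :=
  ∃ x : ℕ → Prop, (x 0 ↔ X) ∧ ∀ r,
    (x (r + 1) ↔ ¬ x r ∧ n.rowLen r = l.rowLen r + 1 ∧ m.rowLen r = l.rowLen r + 1) ∧
    (x r → p.rowLen r = l.rowLen r + 1 ∧ m.rowLen r = l.rowLen r ∧ n.rowLen r = l.rowLen r) ∧
    (¬ x r → p.rowLen r = max (m.rowLen r) (n.rowLen r))

/-- Fomin's rule run backwards; `x r` plays the role of `skel^[r] F i j`. If one of `m`, `n` equals
`p`, then `l` is the other. If `m` and `n` differ from each other and from `p`, then `l` is their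
intersection. If they coincide and `p` adds a cell in row 0, the cell is marked; if it adds one in a
lower row, `l` loses a cell in the row just above. -/
theorem exists_localRule {m n p : YoungDiagram} (hm : Step m p) (hn : Step n p) :
    ∃ (l : YoungDiagram) (X : Prop), Step l m ∧ Step l n ∧ LocalRule l m n p X ∧
      (X → m = l ∧ n = l) := by
  rcases hm.rowLen with rfl | ⟨a, ha⟩
  · exact ⟨n, False, hn, Step.refl n, ⟨fun _ => False, Iff.rfl, fun r => ⟨by simp, by simp,
      fun _ => by have := rowLen_mono hn.1 r; omega⟩⟩, False.elim⟩
  rcases hn.rowLen with rfl | ⟨b, hb⟩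
  · exact ⟨m, False, Step.refl m, hm, ⟨fun _ => False, Iff.rfl, fun r => ⟨by simp, by simp,
      fun _ => by have := rowLen_mono hm.1 r; omega⟩⟩, False.elim⟩
  by_cases hab : a = b
  · subst hab
    obtain rfl : m = n := ext_rowLen fun r => by have := ha r; have := hb r; omega
    rcases a with _ | a
    · refine ⟨m, True, Step.refl m, Step.refl m, ⟨fun r => r = 0, by simp, fun r => ?_⟩,
        fun _ => ⟨rfl, rfl⟩⟩
      have := ha r
      by_cases hr : r = 0
      · subst hr; simpa using this
      · simpa [hr] using this
    -- Row `a` of `m` can be shortened: `p` has an extra cell in row `a + 1`, so that row of `m` is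
    -- strictly shorter than row `a`.
    · have hf : Antitone fun r => m.rowLen r - if r = a then 1 else 0 := by
        refine antitone_nat_of_succ_le fun r => ?_
        have h1 := m.rowLen_anti r (r + 1) (Nat.le_succ r)
        have h2 := p.rowLen_anti r (r + 1) (Nat.le_succ r)
        have h3 := ha r
        have h4 := ha (r + 1)
        split_ifs at * <;> omega
      have hN : (fun r => m.rowLen r - if r = a then 1 else 0) (m.colLen 0) = 0 := by
        have : ¬ (0 < m.rowLen (m.colLen 0)) := by
          rw [← mem_iff_lt_rowLen, mem_iff_lt_colLen]; exact lt_irrefl _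
        simp only
        omega
      have hl : ∀ r, m.rowLen r = (ofRows _ hf _ hN).rowLen r + if r = a then 1 else 0 := by
        intro r
        rw [rowLen_ofRows]
        have h1 := p.rowLen_anti a (a + 1) (Nat.le_succ a)
        have h2 := ha a
        have h3 := ha (a + 1)
        by_cases hr : r = a
        · subst hr; simp at *; omega
        · simp [hr]
      generalize ofRows _ hf _ hN = l at hl
      -- Growth in row `a` on both sides creates a cell of the next iterate, and this cell makes row
      -- `a + 1` of `p` grow.
      refine ⟨l, False, step_of_rowLen hl, step_of_rowLen hl, ⟨fun r => r = a + 1, by simp,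
        fun r => ?_⟩, False.elim⟩
      have h1 := ha r
      have h2 := hl r
      split_ifs at * <;> simp <;> omega
  · refine ⟨m ⊓ n, False, step_of_rowLen (r := b) fun s => ?_, step_of_rowLen (r := a) fun s => ?_,
      ⟨fun _ => False, Iff.rfl, fun r => ⟨?_, by simp, fun _ => ?_⟩⟩, False.elim⟩
    · have := ha s; have := hb s; rw [rowLen_inf]; split_ifs at * <;> omega
    · have := ha s; have := hb s; rw [rowLen_inf]; split_ifs at * <;> omega
    · rw [rowLen_inf]; simp; omega
    · have := ha r; have := hb r; split_ifs at * <;> omega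

theorem IsPartialPerm.label_of_localRule (hF : IsPartialPerm F) {p : YoungDiagram}
    (h : LocalRule (label F i j) (label F (i + 1) j) (label F i (j + 1)) p (F i j)) :
    label F (i + 1) (j + 1) = p := by
  obtain ⟨x, h0, h⟩ := h
  simp only [hF.rowLen_label] at h
  have hx : ∀ r, x r ↔ _root_.skel^[r] F i j := by
    intro r
    induction r with
    | zero => exact h0
    | succ r ih =>
      rw [Function.iterate_succ_apply', _root_.skel, (h r).1, ih]
  refine ext_rowLen fun r => ?_
  rw [hF.rowLen_label, lis_succ_succ]
  have := h r
  rw [← hx]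
  split_ifs with hr
  · have := (h r).2.1 hr; omega
  · have := (h r).2.2 hr; omega

/-- Every sequence of labels on the boundary of the staircase `u + v + 2 ≤ N` comes from a
filling. -/
theorem exists_filling (N : ℕ) (B : ℕ → ℕ → YoungDiagram)
    (hB : ∀ u v, u + v + 1 = N → Step (B u v) (B (u + 1) v) ∧ Step (B u v) (B u (v + 1)))
    (h1 : B 0 N = ⊥) (h2 : B N 0 = ⊥) :
    ∃ F, IsPartialPerm F ∧ (∀ u v, F u v → u + v + 2 ≤ N) ∧
      ∀ u v, u + v = N ∨ u + v + 1 = N → label F u v = B u v := by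
  induction N generalizing B with
  | zero =>
    have hF : IsPartialPerm fun _ _ => False := ⟨fun _ _ _ h => h.elim, fun _ _ _ h => h.elim⟩
    refine ⟨fun _ _ => False, hF, fun _ _ h => h.elim, fun u v huv => ?_⟩
    obtain ⟨rfl, rfl⟩ : u = 0 ∧ v = 0 := by omega
    rw [hF.label_zero_left, h1]
  | succ N ih =>
    have loc : ∀ u v, ∃ (l : YoungDiagram) (X : Prop), u + v + 1 = N →
        Step l (B (u + 1) v) ∧ Step l (B u (v + 1)) ∧
        LocalRule l (B (u + 1) v) (B u (v + 1)) (B (u + 1) (v + 1)) X ∧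
        (X → B (u + 1) v = l ∧ B u (v + 1) = l) := by
      intro u v
      by_cases huv : u + v + 1 = N
      · obtain ⟨l, X, h⟩ := exists_localRule (hB (u + 1) v (by omega)).2
          (hB u (v + 1) (by omega)).1
        exact ⟨l, X, fun _ => h⟩
      · exact ⟨⊥, False, fun h => absurd h huv⟩
    choose l X hl using loc
    -- The boundary of the smaller staircase: its outer antidiagonal keeps the labels `B`, its inner
    -- one gets the corners `l` found by the backward rule.
    obtain ⟨F', hF', hsupp, hlab⟩ := ih (fun u v => if u + v = N then B u v else l u v)
      (by
        intro u v huv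
        have := hl u v huv
        rw [if_neg (by omega), if_pos (by omega), if_pos (by omega)]
        exact ⟨this.1, this.2.1⟩)
      (by
        rw [if_pos (by omega)]
        have := (hB 0 N (by omega)).2.1
        rw [h1] at this
        exact le_bot_iff.1 this)
      (by
        rw [if_pos (by omega)]
        have := (hB N 0 (by omega)).1.1
        rw [h2] at this
        exact le_bot_iff.1 this)
    have hlab1 : ∀ u v, u + v = N → label F' u v = B u v := fun u v huv => by
      rw [hlab u v (Or.inl huv), if_pos huv]
    have hlab2 : ∀ u v, u + v + 1 = N → label F' u v = l u v := fun u v huv => by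
      rw [hlab u v (Or.inr huv), if_neg (by omega)]
    -- A newly marked cell has equal labels at three corners, so `F'` has no cell before it in its
    -- column or row. Adding it keeps a partial permutation.
    have hXF : ∀ u v, u + v + 1 = N → X u v → (∀ y < v, ¬ F' u y) ∧ ∀ x < u, ¬ F' x v := by
      intro u v huv hX
      obtain ⟨e1, e2⟩ := (hl u v huv).2.2.2 hX
      rw [← hlab1 _ _ (by omega), ← hlab2 _ _ huv] at e1 e2
      have n1 := mt hF'.label_left_ne_iff.2 (not_not.2 e1)
      have n2 := mt hF'.label_right_ne_iff.2 (not_not.2 e2)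
      push Not at n1 n2
      exact ⟨n1, n2⟩
    let F : ℕ → ℕ → Prop := fun u v => F' u v ∨ (u + v + 1 = N ∧ X u v)
    have hF : IsPartialPerm F := by
      constructor
      · rintro u v v' (h | ⟨h, hX⟩) (h' | ⟨h', hX'⟩)
        · exact hF'.1 _ _ _ h h'
        · have := hsupp _ _ h
          exact absurd h ((hXF u v' h' hX').1 v (by omega))
        · have := hsupp _ _ h'
          exact absurd h' ((hXF u v h hX).1 v' (by omega))
        · omega
      · rintro u u' v (h | ⟨h, hX⟩) (h' | ⟨h', hX'⟩)
        · exact hF'.2 _ _ _ h h'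
        · have := hsupp _ _ h
          exact absurd h ((hXF u' v h' hX').2 u (by omega))
        · have := hsupp _ _ h'
          exact absurd h' ((hXF u v h hX).2 u' (by omega))
        · omega
    have hlabF : ∀ u v, u + v ≤ N → label F u v = label F' u v := fun u v huv =>
      hF.label_congr hF' fun x hx y hy => or_iff_left fun h => by omega
    refine ⟨F, hF, ?_, fun u v huv => ?_⟩
    · rintro u v (h | ⟨h, -⟩)
      · have := hsupp _ _ h; omega
      · omega
    · rcases huv with huv | huv
      · rcases u with _ | u
        · rw [hF.label_zero_left, show v = N + 1 by omega, h1]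
        rcases v with _ | v
        · rw [hF.label_zero_right, show u + 1 = N + 1 by omega, h2]
        refine hF.label_of_localRule ?_
        rw [hlabF _ _ (by omega), hlabF _ _ (by omega), hlabF _ _ (by omega),
          hlab1 (u + 1) v (by omega), hlab1 u (v + 1) (by omega), hlab2 u v (by omega)]
        have e : F u v ↔ X u v := by
          refine ⟨?_, fun h => Or.inr ⟨by omega, h⟩⟩
          rintro (h | h)
          · have := hsupp _ _ h; omega
          · exact h.2
        rw [propext e]
        exact (hl u v (by omega)).2.2.1
      · rw [hlabF _ _ (by omega), hlab1 _ _ (by omega)]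

end label

section

variable {F G : ℕ → ℕ → Prop} {i j k N : ℕ}

theorem IsPartialPerm.hasIncChain_iff (hF : IsPartialPerm F) :
    HasIncChain F (k + 1) i j ↔ (0, k) ∈ label F i j := by
  rw [mem_iff_lt_rowLen, hF.rowLen_label, ← le_lis_iff]
  rfl

theorem IsPartialPerm.hasDecChain_iff (hF : IsPartialPerm F) :
    HasDecChain F j (k + 1) i 0 ↔ (k, 0) ∈ label F i j := by
  rw [mem_iff_lt_rowLen, hF.rowLen_label, hF.lis_skel_iterate_pos_iff]

theorem IsPartialPerm.exists_transpose (hF : IsPartialPerm F) (N : ℕ) :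
    ∃ G, IsPartialPerm G ∧ (∀ u v, G u v → u + v + 2 ≤ N) ∧
      ∀ u v, u + v = N ∨ u + v + 1 = N → label G u v = (label F u v).transpose :=
  exists_filling N (fun u v => (label F u v).transpose)
    (fun u v _ => ⟨(hF.step_label_left u v).transpose, (hF.step_label_right u v).transpose⟩)
    (by rw [hF.label_zero_left]; rfl) (by rw [hF.label_zero_right]; rfl)

/-- All cells of column `t` lie below the boundary corner `(t, z)`, so the boundary step there
detects whether the column is occupied. -/
theorem IsPartialPerm.exists_col_iff (hF : IsPartialPerm F) (hF' : ∀ u v, F u v → u + v + 2 ≤ N)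
    {t z : ℕ} (h : t + z + 1 = N) : (∃ y, F t y) ↔ label F (t + 1) z ≠ label F t z := by
  rw [hF.label_left_ne_iff]
  refine exists_congr fun y => ⟨fun hy => ⟨?_, hy⟩, fun hy => hy.2⟩
  have := hF' _ _ hy
  omega

theorem IsPartialPerm.exists_row_iff (hF : IsPartialPerm F) (hF' : ∀ u v, F u v → u + v + 2 ≤ N)
    {t z : ℕ} (h : t + z + 1 = N) : (∃ x, F x z) ↔ label F t (z + 1) ≠ label F t z := by
  rw [hF.label_right_ne_iff]
  refine exists_congr fun y => ⟨fun hy => ⟨?_, hy⟩, fun hy => hy.2⟩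
  have := hF' _ _ hy
  omega

end

/-- If a relation between two sets is total and injective in both directions, then the sets are in
bijection. -/
theorem nonempty_equiv_of_relation {α β : Type*} {A : Set α} {B : Set β} (R : α → β → Prop)
    (hA : ∀ a ∈ A, ∃ b ∈ B, R a b) (hB : ∀ b ∈ B, ∃ a ∈ A, R a b)
    (hl : ∀ a a' b, R a b → R a' b → a = a') (hr : ∀ a b b', R a b → R a b' → b = b') :
    Nonempty (A ≃ B) := by
  choose f hf hfR using fun a : A => hA a a.2
  choose g hg hgR using fun b : B => hB b b.2
  -- Choices of related elements in the two directions are both injective, so the Schröder–Bernstein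
  -- theorem applies.
  refine Function.Embedding.antisymm ⟨fun a => ⟨f a, hf a⟩, fun a a' h => ?_⟩
    ⟨fun b => ⟨g b, hg b⟩, fun b b' h => ?_⟩
  · have h : f a = f a' := congrArg Subtype.val h
    exact Subtype.ext (hl _ _ _ (hfR a) (h ▸ hfR a'))
  · have h : g b = g b' := congrArg Subtype.val h
    exact Subtype.ext (hr _ _ _ (hgR b) (h ▸ hgR b'))

/-! ### Matchings as staircase fillings, and the exchange of crossings with nestings -/

namespace OpenMatching

variable {n : ℕ}

/-- The closed arcs of a matching as a filling of a staircase: the arc `(i, j)` is the cell in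
column `i` and row `n - 1 - j`. -/
def filling (M : OpenMatching n) (u v : ℕ) : Prop :=
  ∃ p ∈ M.arcs, p.1.val = u ∧ p.2.val + v + 1 = n

theorem filling_support (M : OpenMatching n) (u v : ℕ) (h : M.filling u v) : u + v + 2 ≤ n := by
  obtain ⟨p, hp, rfl, h⟩ := h
  have : p.1.val < p.2.val := M.lt_of_mem p hp
  omega

theorem isPartialPerm_filling (M : OpenMatching n) : IsPartialPerm M.filling := by
  constructor
  · rintro u v v' ⟨p, hp, h1, h2⟩ ⟨q, hq, h3, h4⟩
    obtain rfl := M.eq_of_common_endpoint p hp q hq p.1 (Or.inl rfl)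
      (Or.inl (Fin.ext (h1.trans h3.symm)))
    omega
  · rintro u u' v ⟨p, hp, h1, h2⟩ ⟨q, hq, h3, h4⟩
    obtain rfl := M.eq_of_common_endpoint p hp q hq p.2 (Or.inr rfl)
      (Or.inr (Fin.ext (by omega)))
    omega

theorem mem_openArcs_iff (M : OpenMatching n) (d : Fin n) {z : ℕ} (hz : d.val + z + 1 = n) :
    d ∈ M.openArcs ↔ ¬ ((∃ y, M.filling d y) ∨ ∃ x, M.filling x z) := by
  constructor
  · rintro hd (⟨y, p, hp, h1, -⟩ | ⟨x, p, hp, -, h2⟩)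
    · exact (M.not_mem_openArcs p hp).1 (by rwa [Fin.ext h1])
    · exact (M.not_mem_openArcs p hp).2 (by rwa [show p.2 = d from Fin.ext (by omega)])
  · intro h
    rcases M.covered d with hd | ⟨p, hp, rfl | rfl⟩
    · exact hd
    · exact absurd (Or.inl ⟨n - 1 - p.2, p, hp, rfl, by omega⟩) h
    · exact absurd (Or.inr ⟨p.1, p, hp, rfl, hz⟩) h

theorem mem_arcs_iff (M : OpenMatching n) (p : Fin n × Fin n) :
    p ∈ M.arcs ↔ M.filling p.1 (n - 1 - p.2) := by
  constructor
  · intro hp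
    exact ⟨p, hp, rfl, by omega⟩
  · rintro ⟨q, hq, h1, h2⟩
    rwa [show p = q from Prod.ext (Fin.ext h1.symm) (Fin.ext (by omega))]

theorem ext_arcs {M M' : OpenMatching n} (h : M.arcs = M'.arcs) : M = M' := by
  have h' : M.openArcs = M'.openArcs := by
    ext d
    rw [M.mem_openArcs_iff d (z := n - 1 - d) (by omega),
      M'.mem_openArcs_iff d (z := n - 1 - d) (by omega)]
    simp only [filling, h]
  cases M
  cases M'
  congr

theorem filling_injective {M M' : OpenMatching n} (h : M.filling = M'.filling) : M = M' :=
  ext_arcs (Finset.ext fun p => by rw [mem_arcs_iff, mem_arcs_iff, h])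

open Classical in
theorem exists_filling_eq {F : ℕ → ℕ → Prop} (hF : IsPartialPerm F)
    (hF' : ∀ u v, F u v → u + v + 2 ≤ n)
    (h : ∀ t z, t + z + 1 = n → ¬ ((∃ y, F t y) ∧ ∃ x, F x z)) :
    ∃ M : OpenMatching n, M.filling = F := by
  let A : Finset (Fin n × Fin n) := Finset.univ.filter fun p => F p.1 (n - 1 - p.2)
  have hA : ∀ p, p ∈ A ↔ F p.1 (n - 1 - p.2) := fun p => by simp [A]
  have hA' : ∀ p ∈ A, ∀ q ∈ A, p.1 ≠ q.2 := fun p hp q hq e =>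
    h p.1 (n - 1 - q.2) (by rw [e]; omega) ⟨⟨_, (hA p).1 hp⟩, ⟨_, (hA q).1 hq⟩⟩
  let M : OpenMatching n :=
    { arcs := A
      openArcs := Finset.univ.filter fun d => ¬ ∃ p ∈ A, d = p.1 ∨ d = p.2
      lt_of_mem := fun p hp => by
        have := hF' _ _ ((hA p).1 hp)
        exact Fin.lt_def.2 (by omega)
      eq_of_common_endpoint := by
        rintro p hp q hq d (rfl | rfl) (hd | hd)
        · have h1 := (hA p).1 hp
          have h2 := (hA q).1 hq
          rw [← hd] at h2
          have := hF.1 _ _ _ h1 h2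
          exact Prod.ext hd (Fin.ext (by omega))
        · exact absurd hd (hA' p hp q hq)
        · exact absurd hd.symm (hA' q hq p hp)
        · have h1 := (hA p).1 hp
          have h2 := (hA q).1 hq
          rw [← hd] at h2
          exact Prod.ext (Fin.ext (hF.2 _ _ _ h1 h2)) hd
      not_mem_openArcs := fun p hp => by
        simp only [Finset.mem_filter, Finset.mem_univ, true_and, not_not]
        exact ⟨⟨p, hp, Or.inl rfl⟩, ⟨p, hp, Or.inr rfl⟩⟩
      covered := fun d => by
        simp only [Finset.mem_filter, Finset.mem_univ, true_and]
        exact (Classical.em _).symm }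
  refine ⟨M, ?_⟩
  funext u v
  refine propext ⟨?_, fun huv => ?_⟩
  · rintro ⟨p, hp, rfl, hv⟩
    have := (hA p).1 hp
    rwa [show n - 1 - p.2.val = v by omega] at this
  · have := hF' _ _ huv
    refine ⟨(⟨u, by omega⟩, ⟨n - 1 - v, by omega⟩), (hA _).2 ?_, rfl, ?_⟩
    · simpa only [show n - 1 - (n - 1 - v) = v by omega] using huv
    · simp only; omega

theorem hasPlainCrossing_iff (M : OpenMatching n) (k : ℕ) : M.HasPlainCrossing (k + 1) ↔
    ∃ u v, u + v = n ∧ (k, 0) ∈ label M.filling u v := by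
  simp only [← M.isPartialPerm_filling.hasDecChain_iff]
  constructor
  · rintro ⟨i, j, hM, hi, hj, hij⟩
    -- The rectangle with corner `(u, n - u)` holds the arcs with left endpoint before `u` and right
    -- endpoint at or after `u`. Cutting at the first right endpoint catches the whole crossing.
    refine ⟨j 0, n - j 0, by omega, fun a => (i a, n - 1 - j a), fun a => ?_, fun a b hab => ?_⟩
    · have h1 : (i a).val < (j 0).val := hij a 0
      have h2 : (j 0).val ≤ (j a).val := hj.monotone (Fin.zero_le a)
      exact ⟨h1, Nat.zero_le _, by simp only; omega, (M.mem_arcs_iff _).1 (hM a)⟩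
    · have h1 : (i a).val < (i b).val := hi hab
      have h2 : (j a).val < (j b).val := hj hab
      simp only; omega
  · rintro ⟨u, v, huv, f, hf, hR⟩
    choose p hp h1 h2 using fun a => (hf a).2.2.2
    refine ⟨fun a => (p a).1, fun a => (p a).2, hp, fun a b hab => ?_, fun a b hab => ?_,
      fun a b => ?_⟩ <;> simp only [Fin.lt_def]
    · have := hR a b hab; have := h1 a; have := h1 b; omega
    · have := hR a b hab; have := h2 a; have := h2 b; omega
    · have := hf a; have := hf b; have := h1 a; have := h2 b; omega

theorem hasPlainNesting_iff (M : OpenMatching n) (k : ℕ) : M.HasPlainNesting (k + 1) ↔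
    ∃ u v, u + v = n ∧ (0, k) ∈ label M.filling u v := by
  simp only [← M.isPartialPerm_filling.hasIncChain_iff]
  constructor
  · rintro ⟨i, j, hM, hi, hj, hij⟩
    -- For a nesting the cut is made just after the last left endpoint.
    refine ⟨i (Fin.last k) + 1, n - (i (Fin.last k) + 1), by omega, fun a => (i a, n - 1 - j a),
      fun a => ?_, fun a b hab => ?_⟩
    · have h1 : (i (Fin.last k)).val < (j a).val := hij _ a
      have h2 : (i a).val ≤ (i (Fin.last k)).val := hi.monotone (Fin.le_last a)
      exact ⟨by simp only; omega, by simp only; omega, (M.mem_arcs_iff _).1 (hM a)⟩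
    · have h1 : (i a).val < (i b).val := hi hab
      have h2 : (j b).val < (j a).val := hj hab
      simp only; omega
  · rintro ⟨u, v, huv, f, hf, hR⟩
    choose p hp h1 h2 using fun a => (hf a).2.2
    refine ⟨fun a => (p a).1, fun a => (p a).2, hp, fun a b hab => ?_, fun a b hab => ?_,
      fun a b => ?_⟩ <;> simp only [Fin.lt_def]
    · have := hR a b hab; have := h1 a; have := h1 b; omega
    · have := hR a b hab; have := h2 a; have := h2 b; omega
    · have := hf a; have := hf b; have := h1 a; have := h2 b; omega

/-- Two matchings of the same length whose growth diagrams have transposed boundary labels. -/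
def IsTransposed (M M' : OpenMatching n) : Prop :=
  ∀ u v, u + v = n ∨ u + v + 1 = n → label M'.filling u v = (label M.filling u v).transpose

variable {M M' : OpenMatching n}

theorem IsTransposed.symm (h : IsTransposed M M') : IsTransposed M' M := fun u v huv => by
  rw [h u v huv, transpose_transpose]

theorem IsTransposed.unique {M'' : OpenMatching n} (h : IsTransposed M M')
    (h' : IsTransposed M M'') : M' = M'' :=
  filling_injective (M'.isPartialPerm_filling.eq_of_label_eq M''.isPartialPerm_filling
    M'.filling_support M''.filling_support fun u v huv => by rw [h u v huv, h' u v huv])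

theorem IsTransposed.hasPlainCrossing_iff (h : IsTransposed M M') (k : ℕ) :
    M'.HasPlainCrossing (k + 1) ↔ M.HasPlainNesting (k + 1) := by
  rw [M'.hasPlainCrossing_iff, M.hasPlainNesting_iff]
  refine exists_congr fun u => exists_congr fun v => and_congr_right fun huv => ?_
  rw [h u v (Or.inl huv), mem_transpose]
  rfl

/-- Transposition is injective, so both label sequences change at the same boundary steps. With `t +
z + 1 = n`, column `t` and row `z` both belong to dot `t`, as left and right endpoint. -/
theorem exists_col_iff_of_label {F G : ℕ → ℕ → Prop} (hF : IsPartialPerm F) (hG : IsPartialPerm G)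
    (hF' : ∀ u v, F u v → u + v + 2 ≤ n) (hG' : ∀ u v, G u v → u + v + 2 ≤ n)
    (h : ∀ u v, u + v = n ∨ u + v + 1 = n → label G u v = (label F u v).transpose)
    {t z : ℕ} (htz : t + z + 1 = n) :
    ((∃ y, G t y) ↔ ∃ y, F t y) ∧ ((∃ x, G x z) ↔ ∃ x, F x z) := by
  rw [hF.exists_col_iff hF' htz, hG.exists_col_iff hG' htz, hF.exists_row_iff hF' htz,
    hG.exists_row_iff hG' htz, h _ _ (Or.inl (by omega)), h _ _ (Or.inr htz),
    h _ _ (Or.inl (by omega))]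
  simp only [ne_eq, transpose_eq_iff, and_self]

theorem IsTransposed.openArcs_eq (h : IsTransposed M M') : M'.openArcs = M.openArcs := by
  ext d
  have hd : d.val + (n - 1 - d) + 1 = n := by omega
  have := exists_col_iff_of_label M.isPartialPerm_filling M'.isPartialPerm_filling
    M.filling_support M'.filling_support h hd
  rw [M.mem_openArcs_iff d hd, M'.mem_openArcs_iff d hd, this.1, this.2]

theorem exists_isTransposed (M : OpenMatching n) : ∃ M', IsTransposed M M' := by
  obtain ⟨G, hG, hG', h⟩ := M.isPartialPerm_filling.exists_transpose n
  -- That no dot is both a left and a right endpoint carries over from `M`, because the occupied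
  -- rows and columns are the same.
  obtain ⟨M', rfl⟩ := exists_filling_eq hG hG' fun t z htz => by
    have := exists_col_iff_of_label M.isPartialPerm_filling hG M.filling_support hG' h htz
    rw [this.1, this.2]
    rintro ⟨⟨y, p, hp, h1, -⟩, ⟨x, q, hq, -, h2⟩⟩
    have e : p.1 = q.2 := Fin.ext (by omega)
    obtain rfl := M.eq_of_common_endpoint p hp q hq p.1 (Or.inl rfl) (Or.inr e)
    exact (M.lt_of_mem p hp).ne e
  exact ⟨M', h⟩

end OpenMatching

open OpenMatching in
theorem noncrossing_equiv_nonnesting (n m k : ℕ) :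
    Nonempty (noncrossingClass n m (k + 1) ≃ nonnestingClass n m (k + 1)) := by
  refine nonempty_equiv_of_relation IsTransposed ?_ ?_ (fun M M' M'' h h' => h.symm.unique h'.symm)
    fun M M' M'' h h' => h.unique h'
  · rintro M ⟨h1, h2⟩
    obtain ⟨M', h⟩ := exists_isTransposed M
    exact ⟨M', ⟨by rw [h.openArcs_eq, h1], by rwa [← h.symm.hasPlainCrossing_iff]⟩, h⟩
  · rintro M ⟨h1, h2⟩
    obtain ⟨M', h⟩ := exists_isTransposed M
    exact ⟨M', ⟨by rw [h.openArcs_eq, h1], by rwa [h.hasPlainCrossing_iff]⟩, h.symm⟩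

/-! ### Involutions and matchings -/

namespace OpenMatching

variable {n : ℕ}

/-- The closed arcs of `M` are the 2-cycles of `σ`. -/
def IsDiagramOf (M : OpenMatching n) (σ : Equiv.Perm (Fin n)) : Prop :=
  Function.Involutive σ ∧ ∀ p, p ∈ M.arcs ↔ p.1 < p.2 ∧ σ p.1 = p.2

variable {M : OpenMatching n} {σ : Equiv.Perm (Fin n)}

theorem IsDiagramOf.mem_openArcs (h : M.IsDiagramOf σ) (d : Fin n) :
    d ∈ M.openArcs ↔ σ d = d := by
  constructor
  · intro hd
    by_contra hne
    rcases lt_or_gt_of_ne hne with hlt | hlt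
    · exact (M.not_mem_openArcs _ ((h.2 (σ d, d)).2 ⟨hlt, h.1 d⟩)).2 hd
    · exact (M.not_mem_openArcs _ ((h.2 (d, σ d)).2 ⟨hlt, rfl⟩)).1 hd
  · intro hd
    rcases M.covered d with hd' | ⟨p, hp, rfl | rfl⟩
    · exact hd'
    · have := (h.2 p).1 hp
      exact absurd (hd.symm.trans this.2) this.1.ne
    · have := (h.2 p).1 hp
      have h' := h.1 p.1
      rw [this.2, hd] at h'
      exact absurd h'.symm this.1.ne

theorem IsDiagramOf.ncard_fixedPoints (h : M.IsDiagramOf σ) :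
    (Function.fixedPoints σ).ncard = M.openArcs.card := by
  rw [← Set.ncard_coe_finset]
  congr 1
  ext d
  exact (h.mem_openArcs d).symm

theorem IsDiagramOf.hasDecreasingSubseq_iff (h : M.IsDiagramOf σ) (k : ℕ) :
    HasDecreasingSubseq σ (2 * k) ↔ M.HasPlainNesting k := by
  constructor
  · rintro ⟨i, hi, hσ⟩
    -- Along the subsequence positions increase and values decrease. So either the first `k`
    -- positions lie below their values, or some such position does not, and then the last `k` all
    -- lie above theirs.
    by_cases hk : ∀ a : Fin (2 * k), a.val < k → i a < σ (i a)
    · refine ⟨fun a => i ⟨a, by omega⟩, fun a => σ (i ⟨a, by omega⟩), fun a => ?_, ?_, ?_, ?_⟩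
      · exact (h.2 _).2 ⟨hk _ a.2, rfl⟩
      · exact fun a b hab => hi hab
      · exact fun a b hab => hσ (show (⟨a, _⟩ : Fin (2 * k)) < ⟨b, _⟩ from hab)
      · intro a b
        rcases le_total a b with hab | hab
        · exact (hi.monotone (show (⟨a, _⟩ : Fin (2 * k)) ≤ ⟨b, by omega⟩ from hab)).trans_lt
            (hk _ b.2)
        · exact (hk _ a.2).trans_le
            (hσ.antitone (show (⟨b, _⟩ : Fin (2 * k)) ≤ ⟨a, by omega⟩ from hab))
    · push Not at hk
      obtain ⟨c, hck, hc⟩ := hk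
      have hk' : ∀ a : Fin (2 * k), k ≤ a.val → σ (i a) < i a := fun a ha => by
        have hca : c < a := Fin.lt_def.2 (by omega)
        exact (hσ hca).trans_le (hc.trans (hi hca).le)
      -- The last `k` terms are read from the end, so that the left endpoints `σ (i _)` increase.
      have hv : ∀ a : Fin k, 2 * k - 1 - a.val < 2 * k := fun a => by omega
      refine ⟨fun a => σ (i ⟨2 * k - 1 - a, hv a⟩), fun a => i ⟨2 * k - 1 - a, hv a⟩,
        fun a => ?_, fun a b hab => ?_, fun a b hab => ?_, fun a b => ?_⟩
      · exact (h.2 _).2 ⟨hk' _ (by simp only; omega), h.1 _⟩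
      · exact hσ (Fin.lt_def.2 (by have := Fin.lt_def.1 hab; simp only; omega))
      · exact hi (Fin.lt_def.2 (by have := Fin.lt_def.1 hab; simp only; omega))
      · rcases le_total a b with hab | hab
        · exact (hσ.antitone (Fin.le_def.2 (by have := Fin.le_def.1 hab; simp only; omega))).trans_lt
            (hk' ⟨2 * k - 1 - b, hv b⟩ (by simp only; omega))
        · exact (hk' ⟨2 * k - 1 - a, hv a⟩ (by simp only; omega)).trans_le
            (hi.monotone (Fin.le_def.2 (by have := Fin.le_def.1 hab; simp only; omega)))
  · rintro ⟨i, j, hM, hi, hj, hij⟩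
    have hσ : ∀ a, σ (i a) = j a := fun a => ((h.2 _).1 (hM a)).2
    have hσ' : ∀ a, σ (j a) = i a := fun a => by rw [← hσ, h.1]
    have hb : ∀ a : Fin (2 * k), ¬ a.val < k → 2 * k - 1 - a.val < k := fun a ha => by omega
    refine ⟨fun a => if ha : a.val < k then i ⟨a, ha⟩ else j ⟨2 * k - 1 - a, hb a ha⟩,
      fun a b hab => ?_, fun a b hab => ?_⟩ <;> have hab' := Fin.lt_def.1 hab <;> simp only <;>
      split_ifs with ha hb'
    · exact hi hab
    · exact hij _ _
    · omega
    · exact hj (Fin.lt_def.2 (by simp only; omega))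
    · rw [hσ, hσ]; exact hj hab
    · omega
    · rw [hσ', hσ]; exact hij _ _
    · rw [hσ', hσ']; exact hi (Fin.lt_def.2 (by simp only; omega))

theorem exists_isDiagramOf (hσ : Function.Involutive σ) : ∃ M, IsDiagramOf M σ := by
  have hinj := σ.injective
  refine ⟨{
    arcs := Finset.univ.filter fun p => p.1 < p.2 ∧ σ p.1 = p.2
    openArcs := Finset.univ.filter fun d => σ d = d
    lt_of_mem := fun p hp => (Finset.mem_filter.1 hp).2.1
    eq_of_common_endpoint := ?_
    not_mem_openArcs := ?_
    covered := ?_ }, hσ, fun p => by simp⟩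
  · rintro ⟨a, b⟩ hp ⟨c, d⟩ hq x h1 h2
    simp only [Finset.mem_filter, Finset.mem_univ, true_and] at hp hq h1 h2
    obtain ⟨hab, rfl⟩ := hp
    obtain ⟨hcd, rfl⟩ := hq
    rcases h1 with rfl | rfl <;> rcases h2 with h2 | h2
    · rw [h2]
    · rw [h2, hσ] at hab; exact absurd hab hcd.asymm
    · rw [← h2, hσ] at hcd; exact absurd hcd hab.asymm
    · rw [hinj h2]
  · rintro ⟨a, b⟩ hp
    simp only [Finset.mem_filter, Finset.mem_univ, true_and] at hp ⊢
    obtain ⟨hab, rfl⟩ := hp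
    rw [hσ]
    exact ⟨hab.ne', hab.ne⟩
  · intro d
    simp only [Finset.mem_filter, Finset.mem_univ, true_and]
    rcases lt_trichotomy (σ d) d with h | h | h
    · exact Or.inr ⟨(σ d, d), ⟨h, hσ d⟩, Or.inr rfl⟩
    · exact Or.inl h
    · exact Or.inr ⟨(d, σ d), ⟨h, rfl⟩, Or.inl rfl⟩

theorem exists_isDiagramOf' (M : OpenMatching n) : ∃ σ, IsDiagramOf M σ := by
  -- `e` is the partner of `d`: the other endpoint of its closed arc, or `d` itself at an open arc.
  have hex : ∀ d, ∃ e, (d, e) ∈ M.arcs ∨ (e, d) ∈ M.arcs ∨ d ∈ M.openArcs ∧ e = d := by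
    intro d
    rcases M.covered d with h | ⟨p, hp, rfl | rfl⟩
    · exact ⟨d, Or.inr (Or.inr ⟨h, rfl⟩)⟩
    · exact ⟨p.2, Or.inl hp⟩
    · exact ⟨p.1, Or.inr (Or.inl hp)⟩
  have huniq : ∀ d e e', ((d, e) ∈ M.arcs ∨ (e, d) ∈ M.arcs ∨ d ∈ M.openArcs ∧ e = d) →
      ((d, e') ∈ M.arcs ∨ (e', d) ∈ M.arcs ∨ d ∈ M.openArcs ∧ e' = d) → e = e' := by
    have h3 : ∀ d e, (d, e) ∈ M.arcs → (e, d) ∈ M.arcs → False := fun d e h h' =>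
      lt_asymm (M.lt_of_mem _ h) (M.lt_of_mem _ h')
    rintro d e e' (h | h | h) (h' | h' | h')
    · exact (Prod.ext_iff.1 (M.eq_of_common_endpoint _ h _ h' d (by simp) (by simp))).2
    · have e1 := M.eq_of_common_endpoint _ h _ h' d (by simp) (by simp)
      rw [Prod.mk.injEq] at e1
      obtain ⟨rfl, rfl⟩ := e1
      rfl
    · exact absurd h'.1 (M.not_mem_openArcs _ h).1
    · have e1 := M.eq_of_common_endpoint _ h _ h' d (by simp) (by simp)
      rw [Prod.mk.injEq] at e1
      obtain ⟨rfl, rfl⟩ := e1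
      rfl
    · exact (Prod.ext_iff.1 (M.eq_of_common_endpoint _ h _ h' d (by simp) (by simp))).1
    · exact absurd h'.1 (M.not_mem_openArcs _ h).2
    · exact absurd h.1 (M.not_mem_openArcs _ h').1
    · exact absurd h.1 (M.not_mem_openArcs _ h').2
    · rw [h.2, h'.2]
  choose f hf using hex
  have hinv : Function.Involutive f := by
    intro d
    refine huniq (f d) _ _ (hf (f d)) ?_
    rcases hf d with h | h | ⟨h, h'⟩
    · exact Or.inr (Or.inl h)
    · exact Or.inl h
    · exact Or.inr (Or.inr ⟨by rwa [h'], h'.symm⟩)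
  refine ⟨hinv.toPerm, hinv, fun p => ⟨fun hp => ⟨M.lt_of_mem p hp, ?_⟩, ?_⟩⟩
  · exact huniq p.1 _ _ (hf p.1) (Or.inl hp)
  · rintro ⟨hlt, h⟩
    change f p.1 = p.2 at h
    rcases hf p.1 with h' | h' | h' <;> rw [h] at h'
    · exact h'
    · exact absurd (M.lt_of_mem _ h') hlt.asymm
    · exact absurd h'.2 hlt.ne'

theorem IsDiagramOf.unique_right {τ : Equiv.Perm (Fin n)} (h : M.IsDiagramOf σ)
    (h' : M.IsDiagramOf τ) : σ = τ := by
  refine Equiv.ext fun d => ?_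
  rcases lt_trichotomy (σ d) d with hd | hd | hd
  · have := ((h'.2 (σ d, d)).1 ((h.2 _).2 ⟨hd, h.1 d⟩)).2
    rw [← h'.1 (σ d)]
    exact congrArg τ this
  · rw [hd, (h'.mem_openArcs d).1 ((h.mem_openArcs d).2 hd)]
  · exact ((h'.2 (d, σ d)).1 ((h.2 _).2 ⟨hd, rfl⟩)).2.symm

end OpenMatching

open OpenMatching in
theorem nonnesting_equiv_involutions (n m k : ℕ) :
    Nonempty (nonnestingClass n m k ≃ involutionsClass n m (2 * k)) := by
  refine nonempty_equiv_of_relation IsDiagramOf ?_ ?_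
    (fun M M' σ h h' => ext_arcs (Finset.ext fun p => by rw [h.2, h'.2]))
    fun M σ τ h h' => h.unique_right h'
  · rintro M ⟨h1, h2⟩
    obtain ⟨σ, h⟩ := exists_isDiagramOf' M
    exact ⟨σ, ⟨h.1, by rw [h.ncard_fixedPoints, h1], by rwa [h.hasDecreasingSubseq_iff]⟩, h⟩
  · rintro σ ⟨h0, h1, h2⟩
    obtain ⟨M, h⟩ := exists_isDiagramOf h0
    exact ⟨M, ⟨by rw [← h.ncard_fixedPoints, h1], by rwa [← h.hasDecreasingSubseq_iff]⟩, h⟩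

/-! ### Standard Young tableaux as chains of diagrams -/

namespace YoungDiagram

/-- The number of columns of odd length is the alternating sum of the row lengths. -/
theorem card_odd_columns (μ : YoungDiagram) {R : ℕ} (hR : μ.colLen 0 ≤ R) :
    (((Finset.range (μ.rowLen 0)).filter fun j => Odd (μ.colLen j)).card : ℤ) =
      ∑ r ∈ Finset.range R, (-1) ^ r * (μ.rowLen r : ℤ) := by
  have h1 : ∀ r, (μ.rowLen r : ℤ) =
      ∑ c ∈ Finset.range (μ.rowLen 0), if r < μ.colLen c then 1 else 0 := by
    intro r
    rw [Finset.sum_boole, Nat.cast_inj]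
    have : (Finset.range (μ.rowLen 0)).filter (fun c => r < μ.colLen c) =
        Finset.range (μ.rowLen r) := by
      ext c
      have := μ.rowLen_anti 0 r (Nat.zero_le r)
      rw [Finset.mem_filter, Finset.mem_range, Finset.mem_range, ← mem_iff_lt_colLen,
        mem_iff_lt_rowLen]
      omega
    rw [this, Finset.card_range]
  -- Summed by columns, a column contributes `1 - 1 + 1 - ⋯`, which is 1 for odd length and 0
  -- otherwise.
  simp only [h1, Finset.mul_sum]
  rw [Finset.sum_comm, Finset.card_filter, Nat.cast_sum]
  refine Finset.sum_congr rfl fun c _ => ?_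
  have h2 : (Finset.range R).filter (fun r => r < μ.colLen c) = Finset.range (μ.colLen c) := by
    ext r
    have := μ.colLen_anti 0 c (Nat.zero_le c)
    rw [Finset.mem_filter, Finset.mem_range, Finset.mem_range]
    omega
  simp only [mul_ite, mul_one, mul_zero]
  rw [← Finset.sum_filter, h2, neg_one_geom_sum]
  by_cases h : Even (μ.colLen c)
  · simp [h]
  · simp [h, Nat.not_even_iff_odd.1 h]

end YoungDiagram

namespace StandardTableau

variable {n : ℕ}

/-- The cells of a standard Young tableau with entries at most `i`. -/
def shapeAt (T : StandardTableau n) (i : ℕ) : YoungDiagram where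
  cells := T.shape.cells.filter fun c => T.tableau c.1 c.2 ≤ i
  isLowerSet := by
    rintro ⟨a, b⟩ ⟨c, d⟩ hle hab
    obtain ⟨h1, h2⟩ := Prod.mk_le_mk.1 hle
    simp only [Finset.coe_filter, Set.mem_ofPred_eq, mem_cells] at hab ⊢
    refine ⟨T.shape.up_left_mem h1 h2 hab.1, le_trans ?_ hab.2⟩
    exact (T.tableau.row_weak_of_le h2 (T.shape.up_left_mem h1 le_rfl hab.1)).trans
      (T.tableau.col_weak h1 hab.1)

theorem mem_shapeAt (T : StandardTableau n) (i : ℕ) (c : ℕ × ℕ) :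
    c ∈ T.shapeAt i ↔ c ∈ T.shape ∧ T.tableau c.1 c.2 ≤ i := by
  rw [← mem_cells, shapeAt, Finset.mem_filter, mem_cells]

theorem entry_mem (T : StandardTableau n) {c : ℕ × ℕ} (hc : c ∈ T.shape) :
    1 ≤ T.tableau c.1 c.2 ∧ T.tableau c.1 c.2 ≤ n :=
  T.bijOn.mapsTo hc

theorem shapeAt_zero (T : StandardTableau n) : T.shapeAt 0 = ⊥ := by
  refine SetLike.ext fun c => ?_
  rw [mem_shapeAt]
  refine iff_of_false (fun h => ?_) (notMem_bot c)
  have := T.entry_mem h.1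
  omega

theorem shapeAt_self (T : StandardTableau n) : T.shapeAt n = T.shape :=
  SetLike.ext fun c => by
    rw [mem_shapeAt]
    exact and_iff_left_of_imp fun h => (T.entry_mem h).2

theorem step_shapeAt (T : StandardTableau n) (i : ℕ) : Step (T.shapeAt i) (T.shapeAt (i + 1)) := by
  constructor
  · intro c hc
    have := (T.mem_shapeAt i c).1 hc
    exact (T.mem_shapeAt (i + 1) c).2 ⟨this.1, by omega⟩
  · rw [Finset.card_le_one]
    intro c hc d hd
    simp only [Finset.mem_sdiff, mem_cells, mem_shapeAt, not_and] at hc hd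
    refine T.bijOn.injOn hc.1.1 hd.1.1 ?_
    have := hc.2 hc.1.1
    have := hd.2 hd.1.1
    show T.tableau c.1 c.2 = T.tableau d.1 d.2
    omega

theorem shapeAt_ne (T : StandardTableau n) {i : ℕ} (hi : i < n) :
    T.shapeAt (i + 1) ≠ T.shapeAt i := by
  obtain ⟨c, hc, h⟩ := T.bijOn.surjOn (show i + 1 ∈ Set.Icc 1 n from ⟨by omega, hi⟩)
  intro he
  have h1 := (T.mem_shapeAt (i + 1) c).2 ⟨hc, h.le⟩
  rw [he, mem_shapeAt] at h1
  have h2 := h1.2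
  simp only at h
  omega

theorem ext_shapeAt {T T' : StandardTableau n} (h : ∀ i ≤ n, T.shapeAt i = T'.shapeAt i) :
    T = T' := by
  have hs : T.shape = T'.shape := by rw [← shapeAt_self, ← shapeAt_self, h n le_rfl]
  have hle : ∀ U V : StandardTableau n, (∀ i ≤ n, U.shapeAt i = V.shapeAt i) →
      ∀ c ∈ V.shape, U.tableau c.1 c.2 ≤ V.tableau c.1 c.2 := by
    intro U V hUV c hc
    have h1 := (V.mem_shapeAt _ c).2 ⟨hc, le_rfl⟩
    rw [← hUV _ (V.entry_mem hc).2, mem_shapeAt] at h1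
    exact h1.2
  have he : ∀ i j, T.tableau i j = T'.tableau i j := by
    intro i j
    by_cases hc : (i, j) ∈ T.shape
    · exact le_antisymm (hle T T' h _ (hs ▸ hc)) (hle T' T (fun i hi => (h i hi).symm) _ hc)
    · rw [T.tableau.zeros hc, T'.tableau.zeros (hs ▸ hc)]
  obtain ⟨s, t, b⟩ := T
  obtain ⟨s', t', b'⟩ := T'
  obtain rfl : s = s' := hs
  obtain rfl : t = t' := SemistandardYoungTableau.ext he
  rfl

-- The entry of a cell is the first index at which the cell appears. Strictness of the steps before
-- `n` makes every value from 1 to `n` occur, and `Step` makes it occur only once.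
open Classical in
theorem exists_shapeAt_eq (D : ℕ → YoungDiagram) (h0 : D 0 = ⊥)
    (hD : ∀ i, Step (D i) (D (i + 1))) (hne : ∀ i < n, D (i + 1) ≠ D i) :
    ∃ T : StandardTableau n, ∀ i ≤ n, T.shapeAt i = D i := by
  have hmono : Monotone D := monotone_nat_of_le_succ fun i => (hD i).1
  let e : ℕ × ℕ → ℕ := fun c => sInf {i | c ∈ D i}
  have hmem : ∀ c ∈ D n, c ∈ D (e c) := fun c hc => Nat.sInf_mem (s := {i | c ∈ D i}) ⟨n, hc⟩
  have he : ∀ c ∈ D n, ∀ i, c ∈ D i ↔ e c ≤ i := fun c hc i =>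
    ⟨fun h => Nat.sInf_le h, fun h => hmono h (hmem c hc)⟩
  have hinj : ∀ c ∈ D n, ∀ d ∈ D n, e c = e d → c = d := by
    intro c hc d hd hcd
    rcases hi : e c with _ | i
    · have := hmem c hc
      rw [hi, h0] at this
      exact absurd this (notMem_bot c)
    · refine Finset.card_le_one.1 (hD i).2 c ?_ d ?_ <;>
        rw [Finset.mem_sdiff, mem_cells, mem_cells]
      · rw [he c hc, he c hc]; omega
      · rw [he d hd, he d hd]; omega
  have hle : ∀ c d : ℕ × ℕ, c.1 ≤ d.1 → c.2 ≤ d.2 → d ∈ D n → c ∈ D n ∧ e c ≤ e d := by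
    intro c d h1 h2 hd
    have hc : c ∈ D n := (D n).up_left_mem h1 h2 hd
    exact ⟨hc, (he c hc _).1 ((D (e d)).up_left_mem h1 h2 (hmem d hd))⟩
  let t : SemistandardYoungTableau (D n) :=
    { entry := fun i j => if (i, j) ∈ D n then e (i, j) else 0
      row_weak' := fun {i j1 j2} hj hc => by
        obtain ⟨h1, h2⟩ := hle (i, j1) (i, j2) le_rfl hj.le hc
        rwa [if_pos hc, if_pos h1]
      col_strict' := fun {i1 i2 j} hi hc => by
        obtain ⟨h1, h2⟩ := hle (i1, j) (i2, j) hi.le le_rfl hc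
        rw [if_pos hc, if_pos h1]
        refine lt_of_le_of_ne h2 fun h => ?_
        have := hinj _ h1 _ hc h
        simp only [Prod.mk.injEq, and_true] at this
        omega
      zeros' := fun hc => if_neg hc }
  have ht : ∀ c ∈ D n, t c.1 c.2 = e c := fun c hc => if_pos hc
  refine ⟨⟨D n, t, ?_, ?_, ?_⟩, fun i hi => SetLike.ext fun c => ?_⟩
  · intro c hc
    have hc : c ∈ D n := hc
    simp only [ht c hc, Set.mem_Icc]
    refine ⟨?_, (he c hc n).1 hc⟩
    by_contra! h
    have := (he c hc 0).2 (by omega)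
    rw [h0] at this
    exact notMem_bot c this
  · intro c hc d hd h
    have hc : c ∈ D n := hc
    have hd : d ∈ D n := hd
    simp only [ht c hc, ht d hd] at h
    exact hinj c hc d hd h
  · rintro i ⟨hi1, hi2⟩
    obtain ⟨i, rfl⟩ : ∃ i', i = i' + 1 := ⟨i - 1, by omega⟩
    have hlt : D i < D (i + 1) := lt_of_le_of_ne (hD i).1 (hne i hi2).symm
    obtain ⟨c, hc, hc'⟩ := Finset.exists_of_ssubset (cells_ssubset_iff.2 hlt)
    rw [mem_cells] at hc hc'
    have hcn : c ∈ D n := hmono hi2 hc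
    refine ⟨c, hcn, ?_⟩
    rw [he c hcn] at hc hc'
    simp only [ht c hcn]
    omega
  · rw [mem_shapeAt]
    constructor
    · rintro ⟨hc, h⟩
      have hc : c ∈ D n := hc
      simp only [ht c hc] at h
      exact (he c hc i).2 h
    · intro hc
      have hcn : c ∈ D n := hmono hi hc
      refine ⟨hcn, ?_⟩
      simp only [ht c hcn]
      exact (he c hcn i).1 hc

end StandardTableau

/-! ### Involutions and standard Young tableaux -/

theorem IsPartialPerm.label_min {F : ℕ → ℕ → Prop} (hF : IsPartialPerm F) {n : ℕ}
    (h : ∀ u v, F u v → u < n ∧ v < n) (u v : ℕ) :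
    label F u v = label F (min u n) (min v n) := by
  have h1 : ∀ u v, label F u v = label F (min u n) v := by
    intro u v
    rcases le_total u n with hu | hu
    · rw [min_eq_left hu]
    · rw [min_eq_right hu]
      induction u, hu using Nat.le_induction with
      | base => rfl
      | succ u hu ih =>
        rw [← ih]
        by_contra hne
        obtain ⟨y, -, hy⟩ := hF.label_left_ne_iff.1 hne
        have := h _ _ hy
        omega
  have h2 : ∀ u v, label F u v = label F u (min v n) := by
    intro u v
    rcases le_total v n with hv | hv
    · rw [min_eq_left hv]
    · rw [min_eq_right hv]
      induction v, hv using Nat.le_induction with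
      | base => rfl
      | succ v hv ih =>
        rw [← ih]
        by_contra hne
        obtain ⟨y, -, hy⟩ := hF.label_right_ne_iff.1 hne
        have := h _ _ hy
        omega
  rw [h1, h2]

open Classical in
/-- Along the diagonal of a symmetric growth diagram, the alternating sum of the row lengths grows
with each marked cell. -/
theorem IsPartialPerm.sum_diagonal {F : ℕ → ℕ → Prop} (hF : IsPartialPerm F)
    (hsymm : _root_.flip F = F) {n : ℕ} :
    ∑ r ∈ Finset.range n, (-1 : ℤ) ^ r * ((label F n n).rowLen r : ℤ) =
      ∑ i ∈ Finset.range n, if F i i then 1 else 0 := by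
  -- By symmetry the two off-diagonal neighbours agree, so from `(i, i)` to `(i + 1, i + 1)` row `r`
  -- grows by one for a cell of `skel^[r] F` at `(i, i)` and by one for a cell of `skel^[r + 1] F`
  -- there. The alternating sum telescopes.
  have hstep : ∀ i R, ∑ r ∈ Finset.range R, (-1 : ℤ) ^ r *
      ((lis (_root_.skel^[r] F) (i + 1) (i + 1) : ℤ) - lis (_root_.skel^[r] F) i i) =
      (if F i i then 1 else 0) - (-1) ^ R * (if _root_.skel^[R] F i i then 1 else 0) := by
    intro i R
    induction R with
    | zero => by_cases h : F i i <;> simp [h]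
    | succ R ih =>
      rw [Finset.sum_range_succ, ih]
      have hd : (lis (_root_.skel^[R] F) (i + 1) (i + 1) : ℤ) - lis (_root_.skel^[R] F) i i =
          (if _root_.skel^[R] F i i then 1 else 0) +
            (if _root_.skel^[R + 1] F i i then 1 else 0) := by
        rw [Function.iterate_succ_apply']
        have hs : lis (_root_.skel^[R] F) i (i + 1) = lis (_root_.skel^[R] F) (i + 1) i := by
          rw [← lis_flip (F := _root_.skel^[R] F), ← skel_iterate_flip, hsymm]
        have hP := hF.skel_iterate R
        generalize _root_.skel^[R] F = G at hs hP ⊢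
        by_cases hG : G i i
        · have := hP.lis_of_mem hG
          rw [if_pos hG, if_neg fun h => h.1 hG]
          omega
        · have h1 := lis_succ_succ_of_not hG
          have h2 := lis_le_succ_left (F := G) i i
          have h3 := lis_succ_left_le (F := G) i i
          rw [if_neg hG]
          by_cases hs' : _root_.skel G i i
          · rw [if_pos hs']
            have := hs'.2.1
            omega
          · rw [if_neg hs']
            have : ¬ lis G i (i + 1) = lis G i i + 1 := fun h => hs' ⟨hG, h, hs ▸ h⟩
            omega
      rw [hd, pow_succ]
      ring
  have key : ∀ m ≤ n, ∑ r ∈ Finset.range n, (-1 : ℤ) ^ r * (lis (_root_.skel^[r] F) m m : ℤ) =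
      ∑ i ∈ Finset.range m, if F i i then 1 else 0 := by
    intro m
    induction m with
    | zero => simp
    | succ m ih =>
      intro hm
      have h := hstep m n
      -- The remainder vanishes, since `skel^[n] F` has no cells in columns before `n`.
      have hn : ¬ _root_.skel^[n] F m m := fun h => by
        have := hF.le_of_skel_iterate h
        omega
      rw [if_neg hn, mul_zero, sub_zero] at h
      rw [Finset.sum_range_succ, ← ih (by omega), ← h, ← Finset.sum_add_distrib]
      exact Finset.sum_congr rfl fun r _ => by ring
  simp only [hF.rowLen_label]
  exact key n le_rfl

/-- The permutation matrix as a filling. -/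
def permFilling {n : ℕ} (σ : Equiv.Perm (Fin n)) (u v : ℕ) : Prop :=
  ∃ a : Fin n, a.val = u ∧ (σ a).val = v

section permFilling

variable {n : ℕ} {σ τ : Equiv.Perm (Fin n)} {T : StandardTableau n}

theorem permFilling_iff (a b : Fin n) : permFilling σ a b ↔ σ a = b := by
  constructor
  · rintro ⟨c, h1, h2⟩
    rw [← Fin.ext h1]
    exact Fin.ext h2
  · intro h
    exact ⟨a, rfl, congrArg Fin.val h⟩

theorem permFilling_lt {u v : ℕ} (h : permFilling σ u v) : u < n ∧ v < n := by
  obtain ⟨a, rfl, rfl⟩ := h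
  exact ⟨a.2, (σ a).2⟩

theorem isPartialPerm_permFilling (σ : Equiv.Perm (Fin n)) : IsPartialPerm (permFilling σ) := by
  constructor
  · rintro u v v' ⟨a, h1, h2⟩ ⟨b, h3, h4⟩
    rw [← h2, ← h4, Fin.ext (h1.trans h3.symm)]
  · rintro u u' v ⟨a, h1, h2⟩ ⟨b, h3, h4⟩
    rw [← h1, ← h3, σ.injective (Fin.ext (h2.trans h4.symm))]

theorem flip_permFilling (hσ : Function.Involutive σ) : flip (permFilling σ) = permFilling σ := by
  funext u v
  refine propext ⟨?_, ?_⟩ <;> rintro ⟨a, rfl, rfl⟩ <;> exact ⟨σ a, rfl, by rw [hσ]⟩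

theorem hasDecreasingSubseq_iff (σ : Equiv.Perm (Fin n)) (k : ℕ) :
    HasDecreasingSubseq σ (k + 1) ↔ (k, 0) ∈ label (permFilling σ) n n := by
  rw [← (isPartialPerm_permFilling σ).hasDecChain_iff]
  constructor
  · rintro ⟨i, hi, hσ⟩
    exact ⟨fun a => (i a, σ (i a)), fun a => ⟨(i a).2, Nat.zero_le _, (σ (i a)).2, i a, rfl, rfl⟩,
      fun a b hab => ⟨hi hab, hσ hab⟩⟩
  · rintro ⟨f, hf, hR⟩
    choose i h1 h2 using fun a => (hf a).2.2.2
    refine ⟨i, fun a b hab => ?_, fun a b hab => ?_⟩ <;> simp only [Fin.lt_def, h1, h2]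
    · exact (hR a b hab).1
    · exact (hR a b hab).2

/-- `T` is the insertion tableau of the involution `σ`. -/
def IsTableauOf (T : StandardTableau n) (σ : Equiv.Perm (Fin n)) : Prop :=
  Function.Involutive σ ∧ ∀ i ≤ n, label (permFilling σ) i n = T.shapeAt i

/-- Labels are constant beyond the `n × n` square, and symmetry reflects the top side of the square
to its right side. So `T` determines the boundary labels of the staircase of size `2 * n`, which
contains the square. -/
theorem IsTableauOf.label_boundary (h : IsTableauOf T σ) {u v : ℕ}
    (huv : u + v = 2 * n ∨ u + v + 1 = 2 * n) :
    label (permFilling σ) u v = T.shapeAt (min u v) := by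
  have hF := isPartialPerm_permFilling σ
  rw [hF.label_min fun u v => permFilling_lt]
  rcases le_total u v with hle | hle
  · rw [min_eq_left hle, min_eq_left (show u ≤ n by omega), min_eq_right (show n ≤ v by omega)]
    exact h.2 u (by omega)
  · rw [min_eq_right hle, min_eq_left (show v ≤ n by omega), min_eq_right (show n ≤ u by omega),
      ← hF.label_flip, flip_permFilling h.1]
    exact h.2 v (by omega)

theorem permFilling_support (σ : Equiv.Perm (Fin n)) (u v : ℕ) (h : permFilling σ u v) :
    u + v + 2 ≤ 2 * n := by
  have := permFilling_lt h
  omega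

theorem IsTableauOf.unique_right (h : IsTableauOf T σ) (h' : IsTableauOf T τ) : σ = τ := by
  have := (isPartialPerm_permFilling σ).eq_of_label_eq (isPartialPerm_permFilling τ)
    (permFilling_support σ) (permFilling_support τ)
    fun u v huv => by rw [h.label_boundary huv, h'.label_boundary huv]
  refine Equiv.ext fun a => ?_
  rw [← permFilling_iff, this, permFilling_iff]

theorem exists_isTableauOf (hσ : Function.Involutive σ) : ∃ T, IsTableauOf T σ := by
  have hF := isPartialPerm_permFilling σ
  obtain ⟨T, hT⟩ := StandardTableau.exists_shapeAt_eq (n := n)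
    (fun i => label (permFilling σ) i n) (hF.label_zero_left n)
    (fun i => hF.step_label_left i n)
    fun i hi => hF.label_left_ne_iff.2 ⟨σ ⟨i, hi⟩, (σ ⟨i, hi⟩).2, ⟨i, hi⟩, rfl, rfl⟩
  exact ⟨T, hσ, fun i hi => (hT i hi).symm⟩

/-- The tableau is placed symmetrically on the boundary. The filling obtained equals its flip by
uniqueness, and the boundary steps show that exactly the first `n` columns are occupied. It is
therefore a symmetric permutation matrix. -/
theorem exists_isTableauOf' (T : StandardTableau n) : ∃ σ, IsTableauOf T σ := by
  obtain ⟨F, hF, hsupp, hlab⟩ := exists_filling (2 * n) (fun u v => T.shapeAt (min u v))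
    (by
      intro u v huv
      rcases lt_or_ge u v with h | h
      · rw [min_eq_left h.le, min_eq_left (show u + 1 ≤ v from h),
          min_eq_left (show u ≤ v + 1 by omega)]
        exact ⟨T.step_shapeAt u, Step.refl _⟩
      · rw [min_eq_right h, min_eq_right (show v ≤ u + 1 by omega),
          min_eq_right (show v + 1 ≤ u by omega)]
        exact ⟨Step.refl _, T.step_shapeAt v⟩)
    (by rw [Nat.zero_min, T.shapeAt_zero]) (by rw [Nat.min_zero, T.shapeAt_zero])
  have hsymm : flip F = F := by
    refine hF.flip.eq_of_label_eq hF (fun u v h => ?_) hsupp fun u v huv => ?_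
    · have := hsupp _ _ h; omega
    · rw [hF.label_flip, hlab u v huv, hlab v u (by omega), min_comm]
  have hcol : ∀ u < n, ∃ v, F u v := by
    intro u hu
    rw [hF.exists_col_iff hsupp (show u + (2 * n - 1 - u) + 1 = 2 * n by omega),
      hlab _ _ (by omega), hlab _ _ (by omega), min_eq_left (by omega), min_eq_left (by omega)]
    exact T.shapeAt_ne hu
  have hlt : ∀ u v, F u v → u < n := by
    intro u v h
    have h1 := hsupp _ _ h
    by_contra! hu
    -- For `u ≥ n` a step in `u` leaves `min u v` unchanged, so the label does not change and the
    -- column is empty.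
    have h2 := (hF.exists_col_iff hsupp (show u + (2 * n - 1 - u) + 1 = 2 * n by omega)).1 ⟨v, h⟩
    rw [hlab _ _ (by omega), hlab _ _ (by omega), min_eq_right (by omega),
      min_eq_right (by omega)] at h2
    exact h2 rfl
  have hs : ∀ u v, F u v ↔ F v u := fun u v => by
    conv_lhs => rw [← hsymm]
    rfl
  have hlt' : ∀ u v, F u v → v < n := fun u v h => hlt v u ((hs u v).1 h)
  choose f hf using fun a : Fin n => hcol a a.2
  let g : Fin n → Fin n := fun a => ⟨f a, hlt' _ _ (hf a)⟩
  have hg : Function.Involutive g := fun a =>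
    Fin.ext (hF.1 _ _ _ (hf (g a)) ((hs _ _).1 (hf a)))
  have hFg : permFilling hg.toPerm = F := by
    funext u v
    refine propext ⟨?_, fun h => ⟨⟨u, hlt u v h⟩, rfl, hF.1 _ _ _ (hf ⟨u, hlt u v h⟩) h⟩⟩
    rintro ⟨a, rfl, rfl⟩
    exact hf a
  refine ⟨hg.toPerm, hg, fun i hi => ?_⟩
  rw [hFg]
  have h1 := hlab i (2 * n - i) (by omega)
  rw [hF.label_min fun u v h => ⟨hlt u v h, hlt' u v h⟩, min_eq_left hi,
    min_eq_right (show n ≤ 2 * n - i by omega), min_eq_left (show i ≤ 2 * n - i by omega)] at h1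
  exact h1

theorem IsTableauOf.shape_eq (h : IsTableauOf T σ) : T.shape = label (permFilling σ) n n := by
  rw [h.2 n le_rfl, T.shapeAt_self]

theorem IsTableauOf.height_le_iff (h : IsTableauOf T σ) (l : ℕ) :
    T.height ≤ l ↔ ¬ HasDecreasingSubseq σ (l + 1) := by
  rw [hasDecreasingSubseq_iff, ← h.shape_eq, mem_iff_lt_colLen, not_lt, StandardTableau.height]

theorem IsTableauOf.numOddColumns_eq (h : IsTableauOf T σ) :
    T.numOddColumns = (Function.fixedPoints σ).ncard := by
  classical
  have hF := isPartialPerm_permFilling σ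
  have hR : T.shape.colLen 0 ≤ n := by
    by_contra! hlt
    rw [← mem_iff_lt_colLen, h.shape_eq, mem_iff_lt_rowLen, hF.rowLen_label,
      hF.lis_skel_iterate_eq_zero le_rfl] at hlt
    exact lt_irrefl _ hlt
  have h1 := T.shape.card_odd_columns hR
  rw [h.shape_eq, hF.sum_diagonal (flip_permFilling h.1), Finset.sum_range, ← h.shape_eq] at h1
  simp only [permFilling_iff, Finset.sum_boole, Nat.cast_inj] at h1
  rw [StandardTableau.numOddColumns, h1, ← Set.ncard_coe_finset]
  congr 1
  ext a
  simp [Function.mem_fixedPoints, Function.IsFixedPt]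

end permFilling

theorem tableaux_equiv_involutions (n m l : ℕ) :
    Nonempty (tableauxClass n m l ≃ involutionsClass n m (l + 1)) := by
  refine nonempty_equiv_of_relation IsTableauOf ?_ ?_
    (fun T T' σ h h' => StandardTableau.ext_shapeAt fun i hi => by rw [← h.2 i hi, ← h'.2 i hi])
    fun T σ τ h h' => h.unique_right h'
  · rintro T ⟨h1, h2⟩
    obtain ⟨σ, h⟩ := exists_isTableauOf' T
    exact ⟨σ, ⟨h.1, by rw [← h.numOddColumns_eq, h1], (h.height_le_iff l).1 h2⟩, h⟩
  · rintro σ ⟨h0, h1, h2⟩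
    obtain ⟨T, h⟩ := exists_isTableauOf h0
    exact ⟨T, ⟨by rw [h.numOddColumns_eq, h1], (h.height_le_iff l).2 h2⟩, h⟩

theorem mainTheorem9 (n m k : ℕ) (hk : 1 ≤ k) :
    Nonempty (tableauxClass n m (2 * k - 1) ≃ involutionsClass n m (2 * k)) ∧
    Nonempty (involutionsClass n m (2 * k) ≃ noncrossingClass n m k) ∧
    Nonempty (noncrossingClass n m k ≃ nonnestingClass n m k) := by
  obtain ⟨k, rfl⟩ : ∃ k', k = k' + 1 := ⟨k - 1, by omega⟩
  obtain ⟨e⟩ := noncrossing_equiv_nonnesting n m k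
  obtain ⟨e'⟩ := nonnesting_equiv_involutions n m (k + 1)
  -- Involutions match nonnesting diagrams directly; noncrossing diagrams are reached from there by
  -- transposing labels.
  exact ⟨tableaux_equiv_involutions n m (2 * (k + 1) - 1), ⟨(e.trans e').symm⟩, ⟨e⟩⟩
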